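/- A conjunctive query with arithmetic comparisons (CQAC) $Q$ consists of a head (a tuple of variables and constants), a finite list of relational atoms (subgoals), and a finite list $\beta$ of comparisons $X\,\theta\,Y$, where $X$ is a variable, $Y$ is a variable or a constant and $\theta\in\{<,>,\le,\ge,=,\neq\}$; every variable of the head and of $\beta$ occurs in some subgoal. Constants are rational numbers. Values are taken from a densely, totally ordered set $D$ into which $\mathbb{Q}$ is embedded in an order-preserving way (for instance $D=\mathbb{Q}$ or $D=\mathbb{R}$). The answer $Q(I)$ on a database $I$ is the set of tuples $h(\mathrm{head}(Q))$ over all assignments $h$ of values of $D$ to the variables such that all subgoals become facts of $I$ and all comparisons become true. $Q_2\sqsubseteq Q_1$ means $Q_2(I)\subseteq Q_1(I)$ for every finite database $I$. **Theorem.** Consider the instances $(Q_1,Q_2)$ where $Q_2$ is any CQAC and $Q_1$ is a CQAC among whose comparisons exactly one is not an equation (while there may be any number of equations). Then the problem of deciding $Q_2\sqsubseteq Q_1$ (numbers and names being written in binary) is in NP. Moreover, polynomially long ordered lists of containment mappings serve as certificates. For a map $\mu$ from the subgoals of $Q_1$ to those of $Q_2$ that preserves relation symbols and arities (equivalently, a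 homomorphism from the relational subgoals of the normalized $Q_1$ to those of the normalized $Q_2$) let $E_\mu$ be the set of equations between terms of $Q_2$ (and constants of $Q_1$) which express that the arguments of every subgoal of $Q_1$ are sent to those of its image, that the head of $Q_1$ is sent to the head of $Q_2$, and that the images of the equations among the comparisons of $Q_1$ hold; let $b_\mu$ be the image under $\mu$ of the comparison of $Q_1$ that is not an equation. There is a polynomial $p$ such that for all instances, with $\beta_2$ the comparisons of $Q_2$, one has $Q_2\sqsubseteq Q_1$ if and only if there is a list $\mu_1,\dots,\mu_k$ of such maps with $k\le p(\text{size of }(Q_1,Q_2))$ such that $$\beta_2\wedge\neg(E_{\mu_1}\wedge b_{\mu_1})\wedge\dots\wedge\neg(E_{\mu_{j-1}}\wedge b_{\mu_{j-1}})\Rightarrow E_{\mu_j}\quad(1\le j\le k),\qquad \beta_2\Rightarrow\bigvee_{j=1}^{k}(E_{\mu_j}\wedge b_{\mu_j})$$ hold for all assignments of values of $D$ to the variables of $Q_2$. -/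

import Mathlib

/-! ## A machine model with a step count, and the class NP -/

namespace CompModel

/-- Finite binary trees: the data on which programs operate. -/
inductive Tree where
  | nil : Tree
  | cons : Tree → Tree → Tree

namespace Tree

/-- The number of nodes, leaves included. -/
def size : Tree → ℕ
  | nil => 1
  | cons a b => a.size + b.size + 1

def hd : Tree → Tree
  | nil => nil
  | cons a _ => a

def tl : Tree → Tree
  | nil => nil
  | cons _ b => b

def ofBool : Bool → Tree
  | false => nil
  | true => cons nil nil

/-- A list `[a₁, …, aₙ]` is the tree `cons a₁ (cons a₂ (… (cons aₙ nil)))`. -/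
def ofList : List Tree → Tree
  | [] => nil
  | a :: l => cons a (ofList l)

/-- Natural numbers are written in binary (least significant bit first). -/
def ofNat (n : ℕ) : Tree := ofList (n.bits.map ofBool)

/-- A rational number is written as sign, numerator and denominator, the latter two in binary. -/
def ofRat (q : ℚ) : Tree :=
  cons (ofBool (decide (q.num < 0))) (cons (ofNat q.num.natAbs) (ofNat q.den))

end Tree

/-- The contents of the program variables `X₀, X₁, X₂, …`. -/
abbrev Store := ℕ → Tree

/-- Expressions of the WHILE language. -/
inductive Expr where
  | var : ℕ → Expr
  | nil : Expr
  | cons : Expr → Expr → Expr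
  | hd : Expr → Expr
  | tl : Expr → Expr
  | eq : Expr → Expr → Expr

namespace Expr

open Classical in
/-- The value of an expression; an equality test returns the tree of a truth value. -/
noncomputable def eval (s : Store) : Expr → Tree
  | var x => s x
  | nil => Tree.nil
  | cons e f => Tree.cons (e.eval s) (f.eval s)
  | hd e => (e.eval s).hd
  | tl e => (e.eval s).tl
  | eq e f => Tree.ofBool (decide (e.eval s = f.eval s))

/-- The number of steps for evaluating an expression. Reading a variable is charged the size of its
value, as for a machine that copies data symbol by symbol; consequently the cost is at least the
size of every value that occurs during the evaluation (up to a constant factor depending only on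
the expression), so that an equality test is paid for as well. -/
def cost (s : Store) : Expr → ℕ
  | var x => (s x).size + 1
  | nil => 1
  | cons e f => e.cost s + f.cost s + 1
  | hd e => e.cost s + 1
  | tl e => e.cost s + 1
  | eq e f => e.cost s + f.cost s + 1

end Expr

/-- Programs of the WHILE language. -/
inductive Prog where
  /-- do nothing -/
  | skip : Prog
  /-- `X := e` -/
  | assign : ℕ → Expr → Prog
  /-- sequential composition -/
  | seq : Prog → Prog → Prog
  /-- if `X` is not `nil` then the first program else the second one -/
  | branch : ℕ → Prog → Prog → Prog
  /-- while `X` is not `nil` repeat the program -/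
  | loop : ℕ → Prog → Prog

/-- `Runs c s t s'`: the program `c`, started in the store `s`, halts after exactly `t` steps in the
store `s'`. As no step can build data larger than what is charged for it, all data present after
`t` steps have total size at most (constant) × (input size + `t`); hence running times agree with
those of multitape Turing machines up to a polynomial. -/
inductive Runs : Prog → Store → ℕ → Store → Prop
  | skip (s : Store) : Runs Prog.skip s 1 s
  | assign (x : ℕ) (e : Expr) (s : Store) :
      Runs (Prog.assign x e) s (e.cost s + 1) (Function.update s x (e.eval s))
  | seq {c d : Prog} {s s' s'' : Store} {t t' : ℕ} :
      Runs c s t s' → Runs d s' t' s'' → Runs (Prog.seq c d) s (t + t') s''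
  | branch_then {x : ℕ} {c d : Prog} {s s' : Store} {t : ℕ} :
      s x ≠ Tree.nil → Runs c s t s' → Runs (Prog.branch x c d) s (t + 1) s'
  | branch_else {x : ℕ} {c d : Prog} {s s' : Store} {t : ℕ} :
      s x = Tree.nil → Runs d s t s' → Runs (Prog.branch x c d) s (t + 1) s'
  | loop_exit {x : ℕ} {c : Prog} {s : Store} :
      s x = Tree.nil → Runs (Prog.loop x c) s 1 s
  | loop_again {x : ℕ} {c : Prog} {s s' s'' : Store} {t t' : ℕ} :
      s x ≠ Tree.nil → Runs c s t s' → Runs (Prog.loop x c) s' t' s'' →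
        Runs (Prog.loop x c) s (t + t' + 1) s''

/-- The initial store: input in `X₀`, certificate in `X₁`, all other variables `nil`. -/
def initStore (w y : Tree) : Store
  | 0 => w
  | 1 => y
  | _ => Tree.nil

/-- The program halts on input `w` and certificate `y` with a value other than `nil` in `X₀`. -/
def Accepts (c : Prog) (w y : Tree) : Prop :=
  ∃ t s, Runs c (initStore w y) t s ∧ s 0 ≠ Tree.nil

/-- The decision problem "given an instance `a : α`, does `Yes a` hold?", instances being written
down by `enc`, is in NP: there is a program (a verifier) that halts on every instance and every
certificate within a number of steps polynomial in their total size, and the yes-instances are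
exactly those that have an accepted certificate of size polynomial in the size of the instance. -/
def InNP {α : Type} (enc : α → Tree) (Yes : α → Prop) : Prop :=
  ∃ (c : Prog) (time len : Polynomial ℕ),
    (∀ (a : α) (y : Tree), ∃ t s, Runs c (initStore (enc a) y) t s ∧
      t ≤ time.eval ((enc a).size + y.size)) ∧
    ∀ a : α, Yes a ↔ ∃ y : Tree, y.size ≤ len.eval (enc a).size ∧ Accepts c (enc a) y

end CompModel

/-! ## Conjunctive queries with arithmetic comparisons -/

namespace CQ

open CompModel

/-- Terms: variables `x₀, x₁, …` and rational constants. -/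
inductive Term where
  | var : ℕ → Term
  | const : ℚ → Term

/-- A relational atom `r(t₁, …, tₙ)`. -/
structure Atom where
  rel : ℕ
  args : List Term

/-- The comparison symbols `<, >, ≤, ≥, =, ≠`. -/
inductive CompOp where
  | lt | gt | le | ge | eq | ne

/-- An arithmetic comparison `X θ Y`: `X` is a variable, `Y` a variable or a constant. -/
structure Comparison where
  lhs : ℕ
  op : CompOp
  rhs : Term

/-- The comparison is an equation. -/
def Comparison.isEquation (e : Comparison) : Bool :=
  match e.op with
  | CompOp.eq => true
  | _ => false

/-- The variable `x` occurs in one of the atoms of the list. -/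
def OccursIn (x : ℕ) (body : List Atom) : Prop :=
  ∃ a ∈ body, Term.var x ∈ a.args

/-- A (safe) conjunctive query with arithmetic comparisons. -/
structure CQAC where
  head : List Term
  body : List Atom
  comps : List Comparison
  head_safe : ∀ x, Term.var x ∈ head → OccursIn x body
  comps_safe : ∀ e ∈ comps, OccursIn e.lhs body ∧ ∀ y, e.rhs = Term.var y → OccursIn y body

/-- Exactly one comparison of the query is not an equation. -/
def CQAC.HasOneAC (Q : CQAC) : Prop :=
  (Q.comps.filter fun e => !e.isEquation).length = 1

section Semantics

variable {D : Type*} [LinearOrder D]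

/-- The value of a term under an assignment `h` of the variables; `ι` interprets the constants. -/
def Term.value (ι : ℚ ↪o D) (h : ℕ → D) : Term → D
  | var x => h x
  | const c => ι c

/-- The truth of a comparison under an assignment. -/
def Comparison.Holds (ι : ℚ ↪o D) (h : ℕ → D) (e : Comparison) : Prop :=
  match e.op with
  | CompOp.lt => h e.lhs < e.rhs.value ι h
  | CompOp.gt => h e.lhs > e.rhs.value ι h
  | CompOp.le => h e.lhs ≤ e.rhs.value ι h
  | CompOp.ge => h e.lhs ≥ e.rhs.value ι h
  | CompOp.eq => h e.lhs = e.rhs.value ι h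
  | CompOp.ne => h e.lhs ≠ e.rhs.value ι h

/-- All comparisons of the query are true under the assignment. -/
def CQAC.CompsHold (ι : ℚ ↪o D) (Q : CQAC) (h : ℕ → D) : Prop :=
  ∀ e ∈ Q.comps, e.Holds ι h

/-- The answer of a query on a database; a database is a set of facts `(r, (d₁, …, dₙ))`. -/
def CQAC.answer (ι : ℚ ↪o D) (Q : CQAC) (I : Set (ℕ × List D)) : Set (List D) :=
  {u | ∃ h : ℕ → D, (∀ a ∈ Q.body, (a.rel, a.args.map (Term.value ι h)) ∈ I) ∧
    Q.CompsHold ι h ∧ u = Q.head.map (Term.value ι h)}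

/-- Query containment `Q₂ ⊑ Q₁`. -/
def Contained (ι : ℚ ↪o D) (Q₂ Q₁ : CQAC) : Prop :=
  ∀ I : Set (ℕ × List D), I.Finite → Q₂.answer ι I ⊆ Q₁.answer ι I

end Semantics

/-! ### Lists of containment mappings -/

/-- A containment mapping from the normalized `Q₁` to the normalized `Q₂`. In a normalized query
every argument position of a relational subgoal carries its own variable, so that a mapping of the
variables that sends subgoals to subgoals amounts to a mapping of subgoals that preserves the
relation symbol and the arity. What normalization moves into equations (repeated variables, and
constants in subgoals), as well as the matching of the heads, is taken care of by `Matches`. -/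
structure ContainmentMapping (Q₁ Q₂ : CQAC) where
  toFun : Fin Q₁.body.length → Fin Q₂.body.length
  rel_eq : ∀ i, (Q₁.body.get i).rel = (Q₂.body.get (toFun i)).rel
  arity_eq : ∀ i, (Q₁.body.get i).args.length = (Q₂.body.get (toFun i)).args.length

section Entailment

variable {D : Type*} [LinearOrder D] {Q₁ Q₂ : CQAC}

/-- The values `g` of the variables of `Q₁` are those which the mapping `μ` prescribes when the
variables of `Q₂` have the values `h`. -/
def ContainmentMapping.Matches (ι : ℚ ↪o D) (μ : ContainmentMapping Q₁ Q₂) (h g : ℕ → D) : Prop :=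
  (∀ i, (Q₁.body.get i).args.map (Term.value ι g) =
    (Q₂.body.get (μ.toFun i)).args.map (Term.value ι h)) ∧
  Q₁.head.map (Term.value ι g) = Q₂.head.map (Term.value ι h)

/-- The images under `μ` of all equations of the normalized `Q₁` are true under `h`. -/
def ContainmentMapping.EquationsHold (ι : ℚ ↪o D) (μ : ContainmentMapping Q₁ Q₂) (h : ℕ → D) :
    Prop :=
  ∃ g, μ.Matches ι h g ∧ ∀ e ∈ Q₁.comps, e.isEquation = true → e.Holds ι g

/-- The images under `μ` of all comparisons of the normalized `Q₁` are true under `h`. -/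
def ContainmentMapping.CompsHold (ι : ℚ ↪o D) (μ : ContainmentMapping Q₁ Q₂) (h : ℕ → D) : Prop :=
  ∃ g, μ.Matches ι h g ∧ Q₁.CompsHold ι g

/-- The list `μ₁, …, μₖ` certifies `Q₂ ⊑ Q₁`, the comparisons being `β₂` and `β₁`: for each `j`
the equations in `μⱼ(β₁)` follow from `β₂ ∧ ¬ μ₁(β₁) ∧ … ∧ ¬ μⱼ₋₁(β₁)`, and
`β₂` implies `μ₁(β₁) ∨ … ∨ μₖ(β₁)`. (As the equations in `μᵢ(β₁)`, `i < j`, have been derived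
before, `¬ μᵢ(β₁)` says here that the image of the only comparison of `Q₁` that is not
an equation is false.) -/
def Certifies (ι : ℚ ↪o D) (L : List (ContainmentMapping Q₁ Q₂)) : Prop :=
  (∀ j : Fin L.length, ∀ h : ℕ → D, Q₂.CompsHold ι h →
    (∀ i : Fin L.length, i < j → ¬ (L.get i).CompsHold ι h) → (L.get j).EquationsHold ι h) ∧
  ∀ h : ℕ → D, Q₂.CompsHold ι h → ∃ μ ∈ L, μ.CompsHold ι h

end Entailment

/-! ### The decision problem -/

def Term.encode : Term → Tree
  | var x => Tree.cons (Tree.ofBool false) (Tree.ofNat x)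
  | const c => Tree.cons (Tree.ofBool true) (Tree.ofRat c)

def Atom.encode (a : Atom) : Tree :=
  Tree.cons (Tree.ofNat a.rel) (Tree.ofList (a.args.map Term.encode))

def CompOp.encode : CompOp → Tree
  | lt => Tree.ofNat 0
  | gt => Tree.ofNat 1
  | le => Tree.ofNat 2
  | ge => Tree.ofNat 3
  | eq => Tree.ofNat 4
  | ne => Tree.ofNat 5

def Comparison.encode (e : Comparison) : Tree :=
  Tree.cons e.op.encode (Tree.cons (Tree.ofNat e.lhs) e.rhs.encode)

def CQAC.encode (Q : CQAC) : Tree :=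
  Tree.cons (Tree.ofList (Q.head.map Term.encode))
    (Tree.cons (Tree.ofList (Q.body.map Atom.encode))
      (Tree.ofList (Q.comps.map Comparison.encode)))

/-- The instances: pairs of queries, the contained one `Q₂` arbitrary, the containing one `Q₁` with
exactly one comparison that is not an equation. -/
structure Instance where
  Q₂ : CQAC
  Q₁ : CQAC
  oneAC : Q₁.HasOneAC

def Instance.encode (a : Instance) : Tree := Tree.cons a.Q₂.encode a.Q₁.encode

end CQ

/-!
Containment fails exactly when some assignment satisfies `β₂` but no containment mapping makes both
its equations and its image of the comparison true.  Since `Q₁` has a single comparison that is not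
an equation, the failure of a mapping `μ` becomes, as soon as the equations `E_μ` are known, one
more fact `¬ b_μ` of the form `t ≤ u`, `t < u` or `t ≠ u`; no case distinction is ever made.
Starting from `β₂` one thus derives facts by the laws of order and by such mappings.  Either the
facts become contradictory, and the mappings used certify the containment, or they do not.  In the
second case a closed consistent set of facts has a rational model in which only provably equal terms
coincide.  If containment held, the model would be the value of a containment mapping whose
equations are then already derived, so that the fact `¬ b_μ` it yields would be false in the model.

There are only quadratically many facts about the terms at hand, whence the polynomial length of
lists and derivations.  In a derivation the comparisons between rational constants are justified by
explicit lines of binary arithmetic, which makes checking a derivation a simple syntactic matter.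
-/

namespace CompModel

namespace Tree

/-- The elements of a tree that is read as a list. -/
def toList : Tree → List Tree
  | nil => []
  | cons a b => a :: toList b

/-- The nonempty suffixes of a tree that is read as a list. -/
def suffixes : Tree → List Tree
  | nil => []
  | cons a b => cons a b :: suffixes b

@[simp] theorem hd_nil : (nil : Tree).hd = nil := rfl
@[simp] theorem tl_nil : (nil : Tree).tl = nil := rfl
@[simp] theorem hd_cons (a b : Tree) : (cons a b).hd = a := rfl
@[simp] theorem tl_cons (a b : Tree) : (cons a b).tl = b := rfl

@[simp] theorem toList_ofList (l : List Tree) : (ofList l).toList = l := by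
  induction l with
  | nil => rfl
  | cons a l ih => simp [ofList, toList, ih]

theorem exists_mem_suffixes_hd {t : Tree} {p : Tree → Prop} :
    (∃ s ∈ t.suffixes, p s.hd) ↔ ∃ a ∈ t.toList, p a := by
  induction t with
  | nil => simp [suffixes, toList]
  | cons a b _ ih => simp [suffixes, toList, ih]

theorem size_pos (t : Tree) : 0 < t.size := by
  cases t <;> simp [size]

theorem size_hd_le (t : Tree) : t.hd.size ≤ t.size := by
  cases t <;> simp only [size, hd] <;> omega

theorem size_tl_le (t : Tree) : t.tl.size ≤ t.size := by
  cases t <;> simp only [size, tl] <;> omega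

theorem ofBool_eq_nil {b : Bool} : ofBool b = nil ↔ b = false := by
  cases b <;> simp [ofBool]

end Tree

theorem Expr.size_eval_le_cost (e : Expr) (s : Store) : (e.eval s).size ≤ e.cost s := by
  induction e with
  | var x => exact Nat.le_succ _
  | nil => exact le_rfl
  | cons e f he hf => exact Nat.succ_le_succ (Nat.add_le_add he hf)
  | hd e he => exact (Tree.size_hd_le _).trans (he.trans (Nat.le_succ _))
  | tl e he => exact (Tree.size_tl_le _).trans (he.trans (Nat.le_succ _))
  | eq e f he hf =>
    have h3 : ∀ b, (Tree.ofBool b).size ≤ 3 := by decide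
    have he' := (Tree.size_pos _).trans_le he
    have hf' := (Tree.size_pos _).trans_le hf
    exact (h3 _).trans (by simp only [cost]; omega)

theorem Runs.deterministic {c : Prog} {s s₁ s₂ : Store} {t₁ t₂ : ℕ}
    (h₁ : Runs c s t₁ s₁) (h₂ : Runs c s t₂ s₂) : t₁ = t₂ ∧ s₁ = s₂ := by
  induction h₁ generalizing t₂ s₂ <;> cases h₂ <;> grind

theorem eval_mono (p : Polynomial ℕ) : Monotone fun n => p.eval n := fun m n h => by
  simp only [Polynomial.eval_eq_sum]
  exact Finset.sum_le_sum fun i _ => Nat.mul_le_mul_left _ (Nat.pow_le_pow_left h i)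

/-- The functions of one tree that are composed of the constructor and the destructors of trees:
those which an expression without equality tests computes. -/
inductive Elementary : (Tree → Tree) → Prop
  | id : Elementary fun v => v
  | nil : Elementary fun _ => Tree.nil
  | cons {f g : Tree → Tree} :
      Elementary f → Elementary g → Elementary fun v => Tree.cons (f v) (g v)
  | hd {f : Tree → Tree} : Elementary f → Elementary fun v => (f v).hd
  | tl {f : Tree → Tree} : Elementary f → Elementary fun v => (f v).tl

namespace Elementary

variable {f g : Tree → Tree}

theorem const : ∀ t : Tree, Elementary fun _ => t
  | Tree.nil => nil
  | Tree.cons a b => (const a).cons (const b)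

theorem comp (hg : Elementary g) (hf : Elementary f) : Elementary fun v => g (f v) := by
  induction hg with
  | id => exact hf
  | nil => exact nil
  | cons _ _ ih ih' => exact ih.cons ih'
  | hd _ ih => exact ih.hd
  | tl _ ih => exact ih.tl

theorem exists_expr (hf : Elementary f) (k : ℕ) :
    ∃ e : Expr, ∃ w : ℕ, ∀ s, e.eval s = f (s k) ∧ e.cost s ≤ w * ((s k).size + 1) := by
  induction hf with
  | id => exact ⟨Expr.var k, 1, fun s => ⟨rfl, by simp [Expr.cost]⟩⟩
  | nil => exact ⟨Expr.nil, 1, fun s => ⟨rfl, by simp [Expr.cost]⟩⟩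
  | cons _ _ ih ih' =>
    obtain ⟨e, w, h⟩ := ih
    obtain ⟨e', w', h'⟩ := ih'
    exact ⟨Expr.cons e e', w + w' + 1, fun s => ⟨by simp only [Expr.eval, (h s).1, (h' s).1],
      by simp only [Expr.cost]; linarith [(h s).2, (h' s).2]⟩⟩
  | hd _ ih =>
    obtain ⟨e, w, h⟩ := ih
    exact ⟨Expr.hd e, w + 1, fun s => ⟨by simp only [Expr.eval, (h s).1],
      by simp only [Expr.cost]; linarith [(h s).2]⟩⟩
  | tl _ ih =>
    obtain ⟨e, w, h⟩ := ih
    exact ⟨Expr.tl e, w + 1, fun s => ⟨by simp only [Expr.eval, (h s).1],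
      by simp only [Expr.cost]; linarith [(h s).2]⟩⟩

end Elementary

/-- The program `c` decides `P` on the content of `X_k` within `p` steps and without changing
`X₁, …, X_k`; it leaves the truth value in `X₀`, where every tree but `nil` means true. -/
def Decides (c : Prog) (k : ℕ) (P : Tree → Prop) (p : Polynomial ℕ) : Prop :=
  ∀ s : Store, ∃ t s', Runs c s t s' ∧ t ≤ p.eval (s k).size ∧
    (s' 0 ≠ Tree.nil ↔ P (s k)) ∧ Set.EqOn s' s (Set.Icc 1 k)

theorem eqOn_update {s : Store} {k x : ℕ} {a : Tree} (hx : x ∉ Set.Icc 1 k) :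
    Set.EqOn (Function.update s x a) s (Set.Icc 1 k) :=
  fun _ hy => Function.update_of_ne (ne_of_mem_of_not_mem hy hx) _ _

theorem Decides.not {c : Prog} {k : ℕ} {P : Tree → Prop} {p : Polynomial ℕ}
    (hc : Decides c k P p) :
    Decides (Prog.seq c (Prog.branch 0 (Prog.assign 0 Expr.nil)
      (Prog.assign 0 (Expr.cons Expr.nil Expr.nil)))) k (fun v => ¬ P v) (p + 5) := by
  intro s
  obtain ⟨t, s', hr, ht, h0, hs⟩ := hc s
  by_cases h : P (s k)
  · refine ⟨_, _, hr.seq (Runs.branch_then (by simpa [h] using h0) (Runs.assign _ _ _)), ?_,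
      by simp [h, Expr.eval], (eqOn_update (by simp)).trans hs⟩
    simp only [Expr.cost, Polynomial.eval_add, Polynomial.eval_ofNat]
    omega
  · refine ⟨_, _, hr.seq (Runs.branch_else (by simpa [h] using h0) (Runs.assign _ _ _)), ?_,
      by simp [h, Expr.eval], (eqOn_update (by simp)).trans hs⟩
    simp only [Expr.cost, Polynomial.eval_add, Polynomial.eval_ofNat]
    omega

theorem Decides.and {c d : Prog} {k : ℕ} {P R : Tree → Prop} {p q : Polynomial ℕ} (hk : 1 ≤ k)
    (hc : Decides c k P p) (hd : Decides d k R q) :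
    Decides (Prog.seq c (Prog.branch 0 d Prog.skip)) k (fun v => P v ∧ R v) (p + q + 2) := by
  intro s
  obtain ⟨t, s', hr, ht, h0, hs⟩ := hc s
  obtain ⟨t', s'', hr', ht', h0', hs'⟩ := hd s'
  rw [hs ⟨hk, le_rfl⟩] at ht' h0'
  by_cases h : P (s k)
  · refine ⟨_, s'', hr.seq (Runs.branch_then (by simpa [h] using h0) hr'), ?_,
      by simpa [h] using h0', hs'.trans hs⟩
    simp only [Polynomial.eval_add, Polynomial.eval_ofNat]
    omega
  · refine ⟨_, s', hr.seq (Runs.branch_else (by simpa [h] using h0) (Runs.skip _)), ?_,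
      by simpa [h] using h0, hs⟩
    simp only [Polynomial.eval_add, Polynomial.eval_ofNat]
    omega

/-- The body of the loop that searches the suffixes of the content of `X_(k+1)`: the test `c` is run
on the pair of the suffix and the content of `X_k`, and a success ends the loop. -/
def searchBody (k : ℕ) (c : Prog) : Prog :=
  Prog.seq (Prog.assign (k + 2) (Expr.cons (Expr.var (k + 1)) (Expr.var k)))
    (Prog.seq c
      (Prog.branch 0 (Prog.assign (k + 1) Expr.nil)
        (Prog.assign (k + 1) (Expr.tl (Expr.var (k + 1))))))

section Search

variable {c : Prog} {k : ℕ} {P : Tree → Prop} {p : Polynomial ℕ}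

theorem runs_searchBody (hc : Decides c (k + 2) P p) (s : Store) :
    ∃ t s', Runs (searchBody k c) s t s' ∧
      t ≤ 2 * (s (k + 1)).size + (s k).size + 9 +
        p.eval ((s (k + 1)).size + (s k).size + 1) ∧
      (s' 0 ≠ Tree.nil ↔ P (Tree.cons (s (k + 1)) (s k))) ∧
      (P (Tree.cons (s (k + 1)) (s k)) → s' (k + 1) = Tree.nil) ∧
      (¬ P (Tree.cons (s (k + 1)) (s k)) → s' (k + 1) = (s (k + 1)).tl) ∧
      Set.EqOn s' s (Set.Icc 1 k) := by
  set e := Expr.cons (Expr.var (k + 1)) (Expr.var k)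
  have hpair := Runs.assign (k + 2) e s
  set s₁ := Function.update s (k + 2) (e.eval s)
  have hs₁ : Set.EqOn s₁ s (Set.Icc 1 (k + 1)) := eqOn_update (by simp)
  have hv : s₁ (k + 2) = Tree.cons (s (k + 1)) (s k) := Function.update_self ..
  obtain ⟨t, s₂, htest, ht, h0, hs₂⟩ := hc s₁
  rw [hv] at ht h0
  replace hs₂ := (hs₂.mono (Set.Icc_subset_Icc_right (Nat.le_succ _))).trans hs₁
  have hs₂k := hs₂.mono (Set.Icc_subset_Icc_right (Nat.le_succ k))
  have hsucc : s₂ (k + 1) = s (k + 1) := hs₂ (by simp)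
  simp only [Tree.size] at ht
  by_cases h : P (Tree.cons (s (k + 1)) (s k))
  · refine ⟨_, _, hpair.seq (htest.seq (Runs.branch_then (by simpa [h] using h0)
      (Runs.assign _ _ _))), ?_, by simpa using h0, by simp [Expr.eval],
      fun h' => absurd h h',
      (eqOn_update (by simp)).trans hs₂k⟩
    simp only [e, Expr.cost]
    omega
  · refine ⟨_, _, hpair.seq (htest.seq (Runs.branch_else (by simpa [h] using h0)
      (Runs.assign _ _ _))), ?_, by simpa using h0, fun h' => absurd h' h,
      by simp [Expr.eval, hsucc],
      (eqOn_update (by simp)).trans hs₂k⟩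
    simp only [e, Expr.cost, hsucc]
    omega

theorem runs_search (hk : 1 ≤ k) (hc : Decides c (k + 2) P p) (u v : Tree) (M : ℕ)
    (hu : u.size ≤ M) (s : Store) (hsu : s (k + 1) = u) (hsv : s k = v) (h0 : s 0 = Tree.nil) :
    ∃ t s', Runs (Prog.loop (k + 1) (searchBody k c)) s t s' ∧
      t ≤ u.size * (2 * M + v.size + 10 + p.eval (M + v.size + 1)) + 1 ∧
      (s' 0 ≠ Tree.nil ↔ ∃ w ∈ u.suffixes, P (Tree.cons w v)) ∧
      Set.EqOn s' s (Set.Icc 1 k) := by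
  induction u generalizing s with
  | nil => exact ⟨1, s, Runs.loop_exit hsu, by simp, by simp [h0, Tree.suffixes],
      Set.eqOn_refl _ _⟩
  | cons a b _ ih =>
    have hloop : s (k + 1) ≠ Tree.nil := by simp [hsu]
    obtain ⟨t, s₁, hbody, ht, h0₁, hyes, hno, hs₁⟩ := runs_searchBody hc s
    rw [hsu, hsv] at ht h0₁ hyes hno
    have hmono := eval_mono p (Nat.add_le_add_right (Nat.add_le_add_right hu v.size) 1)
    have ha := a.size_pos
    simp only [Tree.size] at ht hu hmono ⊢
    by_cases h : P (Tree.cons (Tree.cons a b) v)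
    · refine ⟨_, s₁, Runs.loop_again hloop hbody (Runs.loop_exit (hyes h)), ?_,
        by simp [h0₁, h, Tree.suffixes], hs₁⟩
      nlinarith
    · obtain ⟨t', s₂, hrest, ht', h0₂, hs₂⟩ := ih (by omega) s₁ (hno h)
        (by rw [hs₁ ⟨hk, le_rfl⟩, hsv]) (by simpa [h] using h0₁)
      refine ⟨_, s₂, Runs.loop_again hloop hbody hrest, ?_,
        by simp [h0₂, h, Tree.suffixes], hs₂.trans hs₁⟩
      nlinarith

end Search

/-- A predicate of trees that programs decide in polynomial time, wherever its argument is stored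
and whichever earlier variables have to be kept. -/
def Checkable (P : Tree → Prop) : Prop := ∀ k, 1 ≤ k → ∃ c p, Decides c k P p

namespace Checkable

variable {f g : Tree → Tree} {P R : Tree → Prop}

theorem eq (hf : Elementary f) (hg : Elementary g) : Checkable fun v => f v = g v := by
  intro k _
  obtain ⟨e, w, he⟩ := hf.exists_expr k
  obtain ⟨e', w', he'⟩ := hg.exists_expr k
  refine ⟨Prog.assign 0 (Expr.eq e e'), Polynomial.C (w + w') * (Polynomial.X + 1) + 2, fun s =>
    ⟨_, _, Runs.assign _ _ s, ?_, by simp [Expr.eval, (he s).1, (he' s).1, Tree.ofBool_eq_nil],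
      eqOn_update (by simp)⟩⟩
  simp only [Expr.cost, Polynomial.eval_add, Polynomial.eval_mul, Polynomial.eval_C,
    Polynomial.eval_X, Polynomial.eval_one, Polynomial.eval_ofNat]
  linarith [(he s).2, (he' s).2]

theorem not (hP : Checkable P) : Checkable fun v => ¬ P v := by
  intro k hk
  obtain ⟨c, p, hc⟩ := hP k hk
  exact ⟨_, _, hc.not⟩

theorem and (hP : Checkable P) (hR : Checkable R) : Checkable fun v => P v ∧ R v := by
  intro k hk
  obtain ⟨c, p, hc⟩ := hP k hk
  obtain ⟨d, q, hd⟩ := hR k hk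
  exact ⟨_, _, hc.and hk hd⟩

theorem comp (hP : Checkable P) (hf : Elementary f) : Checkable fun v => P (f v) := by
  intro k _
  obtain ⟨e, w, he⟩ := hf.exists_expr k
  obtain ⟨c, p, hc⟩ := hP (k + 1) (by omega)
  let q := Polynomial.C w * (Polynomial.X + 1)
  refine ⟨Prog.seq (Prog.assign (k + 1) e) c, q + 1 + p.comp q, fun s => ?_⟩
  obtain ⟨t, s', hr, ht, h0, hs'⟩ := hc (Function.update s (k + 1) (e.eval s))
  rw [Function.update_self] at ht h0
  refine ⟨_, s', (Runs.assign _ _ s).seq hr, ?_, by rw [h0, (he s).1],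
    (hs'.mono (Set.Icc_subset_Icc_right k.le_succ)).trans (eqOn_update (by simp))⟩
  have ht' := ht.trans (eval_mono p ((e.size_eval_le_cost s).trans (he s).2))
  simp only [q, Polynomial.eval_add, Polynomial.eval_mul, Polynomial.eval_C,
    Polynomial.eval_X, Polynomial.eval_one, Polynomial.eval_comp]
  linarith [(he s).2]

theorem exists_suffix {B : Tree → Tree → Prop} (hf : Elementary f)
    (hB : Checkable fun v => B v.hd v.tl) :
    Checkable fun v => ∃ s ∈ (f v).suffixes, B s v := by
  intro k hk
  obtain ⟨e, w, he⟩ := hf.exists_expr k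
  obtain ⟨c, p, hc⟩ := hB (k + 2) (by omega)
  let q := Polynomial.C w * (Polynomial.X + 1)
  refine ⟨Prog.seq (Prog.assign 0 Expr.nil) (Prog.seq (Prog.assign (k + 1) e)
    (Prog.loop (k + 1) (searchBody k c))), q + 4 + q * (2 * q + Polynomial.X + 10 +
      p.comp (q + Polynomial.X + 1)), fun s => ?_⟩
  have hinit := Runs.assign 0 Expr.nil s
  set s₁ := Function.update s 0 (Expr.nil.eval s)
  have hs₁ : Set.EqOn s₁ s (Set.Icc 1 k) := eqOn_update (by simp)
  have hk₁ : s₁ k = s k := hs₁ ⟨hk, le_rfl⟩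
  have hlist := Runs.assign (k + 1) e s₁
  obtain ⟨heval, hcost⟩ := he s₁
  have hsize := e.size_eval_le_cost s₁
  rw [hk₁] at heval hcost
  rw [heval] at hlist hsize
  set s₂ := Function.update s₁ (k + 1) (f (s k))
  have hs₂ : Set.EqOn s₂ s₁ (Set.Icc 1 k) := eqOn_update (by simp)
  obtain ⟨t, s', hsearch, ht, h0, hs'⟩ := runs_search hk hc (f (s k)) (s k) _
    (hsize.trans hcost) s₂ (Function.update_self ..) (by rw [hs₂ ⟨hk, le_rfl⟩, hk₁])
    ((Function.update_of_ne (by omega) _ _).trans (Function.update_self ..))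
  refine ⟨_, s', hinit.seq (hlist.seq hsearch), ?_, h0, hs'.trans (hs₂.trans hs₁)⟩
  have hmul := Nat.mul_le_mul_right (2 * (w * ((s k).size + 1)) + (s k).size + 10 +
    p.eval (w * ((s k).size + 1) + (s k).size + 1)) (hsize.trans hcost)
  simp only [q, Expr.cost, Polynomial.eval_add, Polynomial.eval_mul, Polynomial.eval_C,
    Polynomial.eval_X, Polynomial.eval_one, Polynomial.eval_ofNat, Polynomial.eval_comp]
  omega

theorem of_iff (hP : Checkable P) (h : ∀ v, P v ↔ R v) : Checkable R := by
  rwa [← funext fun v => propext (h v)]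

theorem or (hP : Checkable P) (hR : Checkable R) : Checkable fun v => P v ∨ R v :=
  (hP.not.and hR.not).not.of_iff fun _ => by tauto

theorem imp (hP : Checkable P) (hR : Checkable R) : Checkable fun v => P v → R v :=
  (hP.and hR.not).not.of_iff fun _ => by tauto

theorem forall_suffix {B : Tree → Tree → Prop} (hf : Elementary f)
    (hB : Checkable fun v => B v.hd v.tl) : Checkable fun v => ∀ s ∈ (f v).suffixes, B s v :=
  (exists_suffix (B := fun s v => ¬ B s v) hf hB.not).not.of_iff fun v => by simp

theorem exists_mem {B : Tree → Tree → Prop} (hf : Elementary f)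
    (hB : Checkable fun v => B v.hd v.tl) : Checkable fun v => ∃ a ∈ (f v).toList, B a v :=
  (exists_suffix (B := fun s v => B s.hd v) hf
    (hB.comp (Elementary.id.hd.hd.cons Elementary.id.tl))).of_iff fun v =>
    Tree.exists_mem_suffixes_hd (p := fun a => B a v)

theorem forall_mem {B : Tree → Tree → Prop} (hf : Elementary f)
    (hB : Checkable fun v => B v.hd v.tl) : Checkable fun v => ∀ a ∈ (f v).toList, B a v :=
  (exists_mem (B := fun s v => ¬ B s v) hf hB.not).not.of_iff fun v => by simp

theorem mem (hf : Elementary f) (hg : Elementary g) : Checkable fun v => f v ∈ (g v).toList :=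
  (exists_mem (B := fun b v => f v = b) hg
    (eq (hf.comp Elementary.id.tl) Elementary.id.hd)).of_iff fun v => by simp

end Checkable

/-- On input `w` and certificate `y` the verifier puts the pair `(w, y)` into `X₂` and checks it. -/
theorem exists_verifier {P : Tree → Prop} (hP : Checkable P) :
    ∃ (c : Prog) (time : Polynomial ℕ), ∀ w y, ∃ t s, Runs c (initStore w y) t s ∧
      t ≤ time.eval (w.size + y.size) ∧ (s 0 ≠ Tree.nil ↔ P (Tree.cons w y)) := by
  obtain ⟨c, p, hc⟩ := hP 2 (by omega)
  refine ⟨Prog.seq (Prog.assign 2 (Expr.cons (Expr.var 0) (Expr.var 1))) c,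
    Polynomial.X + 4 + p.comp (Polynomial.X + 1), fun w y => ?_⟩
  have hpair := Runs.assign 2 (Expr.cons (Expr.var 0) (Expr.var 1)) (initStore w y)
  obtain ⟨t, s, hr, ht, h0, -⟩ := hc (Function.update (initStore w y) 2
    ((Expr.cons (Expr.var 0) (Expr.var 1)).eval (initStore w y)))
  simp only [Function.update_self, Expr.eval, initStore, Tree.size] at ht h0
  refine ⟨_, s, hpair.seq hr, ?_, h0⟩
  simp only [Expr.cost, initStore, Polynomial.eval_add, Polynomial.eval_comp, Polynomial.eval_X,
    Polynomial.eval_one, Polynomial.eval_ofNat]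
  omega

theorem inNP_of_checkable {α : Type} {enc : α → Tree} {Yes : α → Prop} {P : Tree → Prop}
    (hP : Checkable P) (len : Polynomial ℕ)
    (sound : ∀ a y, P (Tree.cons (enc a) y) → Yes a)
    (complete : ∀ a, Yes a → ∃ y : Tree, y.size ≤ len.eval (enc a).size ∧
      P (Tree.cons (enc a) y)) : InNP enc Yes := by
  obtain ⟨c, time, hc⟩ := exists_verifier hP
  have accepts_iff (w y : Tree) : Accepts c w y ↔ P (Tree.cons w y) := by
    obtain ⟨t, s, hr, -, h⟩ := hc w y
    refine ⟨?_, fun hp => ⟨t, s, hr, h.2 hp⟩⟩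
    rintro ⟨t', s', hr', h'⟩
    obtain ⟨-, rfl⟩ := hr.deterministic hr'
    exact h.1 h'
  refine ⟨c, time, len, fun a y => ?_, fun a => ?_⟩
  · obtain ⟨t, s, hr, ht, -⟩ := hc (enc a) y
    exact ⟨t, s, hr, ht⟩
  · simp only [accepts_iff]
    exact ⟨complete a, fun ⟨y, _, hy⟩ => sound a y hy⟩

namespace Tree

/-- The number with the given binary digits, least significant first. -/
def num : Tree → ℕ
  | nil => 0
  | cons nil b => 2 * num b
  | cons (cons _ _) b => 2 * num b + 1

/-- The digit that a tree stands for: `0` for `nil` and `1` for every other tree. -/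
def digit : Tree → ℕ
  | nil => 0
  | cons _ _ => 1

/-- The rational number with the given sign, numerator and denominator, inverse to `ofRat`; it is
`0` by `x / 0 = 0` if the denominator is zero. -/
def rat (t : Tree) : ℚ :=
  (if t.hd.digit = 0 then (t.tl.hd.num : ℚ) else -(t.tl.hd.num : ℚ)) / t.tl.tl.num

theorem num_eq (t : Tree) : t.num = t.hd.digit + 2 * t.tl.num := by
  match t with
  | nil => simp [num, digit]
  | cons nil b => simp [num, digit]
  | cons (cons _ _) b => simp [num, digit, add_comm]

theorem digit_le_one (t : Tree) : t.digit ≤ 1 := by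
  cases t <;> simp [digit]

theorem digit_eq_zero {t : Tree} : t.digit = 0 ↔ t = nil := by
  cases t <;> simp [digit]

theorem num_ofNat (n : ℕ) : (ofNat n).num = n := by
  induction n using Nat.binaryRec' with
  | zero => simp [ofNat, ofList, num]
  | bit b n h ih =>
    rw [ofNat, Nat.bits_append_bit n b h]
    cases b <;> simp only [List.map_cons, ofList, ofBool, num] <;> rw [← ofNat, ih] <;>
      simp [Nat.bit]

theorem ofNat_injective : Function.Injective ofNat :=
  Function.LeftInverse.injective num_ofNat

theorem rat_ofRat (q : ℚ) : (ofRat q).rat = q := by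
  have hq := Rat.num_div_den q
  rcases lt_or_ge q.num 0 with h | h
  · simpa [ofRat, rat, num_ofNat, h, ofBool, digit, Nat.cast_natAbs, abs_of_neg h] using hq
  · simpa [ofRat, rat, num_ofNat, h.not_gt, ofBool, digit, Nat.cast_natAbs, abs_of_nonneg h]
      using hq

theorem num_ne_zero {t : Tree} : t.num ≠ 0 ↔ ∃ b ∈ t.toList, b ≠ nil := by
  induction t with
  | nil => simp [num, toList]
  | cons a b _ ih =>
    rw [num_eq]
    simp [toList, ← ih, digit_eq_zero, imp_iff_not_or]

theorem num_lt_two_pow (t : Tree) : t.num < 2 ^ t.size := by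
  induction t with
  | nil => simp [num]
  | cons a b _ ih =>
    have ha := a.digit_le_one
    calc (cons a b).num < 2 ^ (b.size + 1) := by
          rw [num_eq, pow_succ]; simp only [hd_cons, tl_cons]; omega
      _ ≤ 2 ^ (cons a b).size := Nat.pow_le_pow_right two_pos (by simp only [size]; omega)

theorem size_ofList_le {l : List Tree} {m : ℕ} (h : ∀ t ∈ l, t.size ≤ m) :
    (ofList l).size ≤ l.length * (m + 1) + 1 := by
  induction l with
  | nil => simp [ofList, size]
  | cons a l ih =>
    have ha := h a List.mem_cons_self
    have hl := ih fun t ht => h t (List.mem_cons_of_mem _ ht)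
    simp only [ofList, size, List.length_cons]
    linarith

theorem size_ofNat_le {n k : ℕ} (h : n < 2 ^ k) : (ofNat n).size ≤ 4 * k + 1 := by
  have hdigits : ∀ t ∈ n.bits.map ofBool, t.size ≤ 3 := by
    rintro _ ht
    obtain ⟨b, -, rfl⟩ := List.mem_map.1 ht
    cases b <;> simp [ofBool, size]
  have hlength : (n.bits.map ofBool).length ≤ k := by
    rw [List.length_map, Nat.size_eq_bits_len]
    exact Nat.size_le.2 h
  have := size_ofList_le hdigits
  rw [ofNat]
  omega

theorem size_le_size_ofList {l : List Tree} {t : Tree} (h : t ∈ l) :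
    t.size ≤ (ofList l).size := by
  induction l with
  | nil => simp at h
  | cons a l ih =>
    simp only [ofList, size]
    rcases List.mem_cons.1 h with rfl | h
    · omega
    · have := ih h; omega

theorem length_le_size_ofList (l : List Tree) : l.length ≤ (ofList l).size := by
  induction l with
  | nil => simp
  | cons a l ih => simp only [ofList, size, List.length_cons]; omega

end Tree

namespace Checkable

variable {f : Tree → Tree}

theorem const (p : Prop) : Checkable fun _ => p := by
  by_cases h : p
  · exact (eq .nil .nil).of_iff fun _ => by simp [h]
  · exact (eq .nil .nil).not.of_iff fun _ => by simp [h]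

theorem digit {P : ℕ → Tree → Prop} (hf : Elementary f) (hP : ∀ n, Checkable (P n)) :
    Checkable fun v => P (f v).digit v := by
  have hnil := eq hf .nil
  refine ((hnil.imp (hP 0)).and (hnil.not.imp (hP 1))).of_iff fun v => ?_
  cases f v <;> simp [Tree.digit]

theorem num_ne_zero (hf : Elementary f) : Checkable fun v => (f v).num ≠ 0 := by
  simp only [Tree.num_ne_zero]
  exact exists_mem hf (eq Elementary.id.hd .nil).not

theorem exists_mem_of_leftInverse {F : Tree → Tree → Tree} {r : Tree → Tree}
    {B : Tree → Tree → Prop} (hrF : ∀ m v, r (F m v) = m) (hf : Elementary f) (hr : Elementary r)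
    (hF : Elementary fun v => F v.hd v.tl) (hB : Checkable fun v => B v.hd v.tl) :
    Checkable fun v => ∃ m, F m v ∈ (f v).toList ∧ B m v := by
  have hpair := (hr.comp Elementary.id.hd).cons Elementary.id.tl
  refine (exists_mem (B := fun a v => a = F (r a) v ∧ B (r a) v) hf
    ((eq Elementary.id.hd (hF.comp hpair)).and (hB.comp hpair))).of_iff fun v => ⟨?_, ?_⟩
  · rintro ⟨a, ha, haF, hB⟩
    exact ⟨r a, haF ▸ ha, hB⟩
  · rintro ⟨m, hm, hB⟩
    exact ⟨F m v, hm, by simp only [hrF, true_and]; exact hB⟩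

end Checkable

end CompModel

namespace CQ

open CompModel

/-- An order relation between two elements of `α` (terms of a query, or codes of such terms). -/
inductive Fact (α : Type*) where
  | le : α → α → Fact α
  | lt : α → α → Fact α
  | ne : α → α → Fact α

/-- Both sides of the fact belong to `T`. -/
def Fact.Over {α : Type*} (T : Set α) : Fact α → Prop
  | le t u => t ∈ T ∧ u ∈ T
  | lt t u => t ∈ T ∧ u ∈ T
  | ne t u => t ∈ T ∧ u ∈ T

/-- The truth of a fact when the elements of `α` have the values `v`. -/
def Fact.Holds {α D : Type*} [LinearOrder D] (v : α → D) : Fact α → Prop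
  | le t u => v t ≤ v u
  | lt t u => v t < v u
  | ne t u => v t ≠ v u

/-- The relation that a comparison symbol stands for. -/
def CompOp.Rel {D : Type*} [LinearOrder D] (a b : D) : CompOp → Prop
  | lt => a < b
  | gt => a > b
  | le => a ≤ b
  | ge => a ≥ b
  | eq => a = b
  | ne => a ≠ b

/-- A list of facts whose conjunction is equivalent to the comparison `l θ r`. -/
def CompOp.asserts {α : Type*} (l r : α) : CompOp → List (Fact α)
  | lt => [Fact.lt l r]
  | gt => [Fact.lt r l]
  | le => [Fact.le l r]
  | ge => [Fact.le r l]
  | eq => [Fact.le l r, Fact.le r l]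
  | ne => [Fact.ne l r]

/-- A list of facts whose conjunction is equivalent to the negation of `l θ r`, where `θ` is not
`=`. For `=`, whose negation is never needed, the list is empty. -/
def CompOp.refutes {α : Type*} (l r : α) : CompOp → List (Fact α)
  | lt => [Fact.le r l]
  | gt => [Fact.le l r]
  | le => [Fact.lt r l]
  | ge => [Fact.lt l r]
  | eq => []
  | ne => [Fact.le l r, Fact.le r l]

/-- The fact follows in one step from those of `F` by a rule for linear orders. -/
def OrderStep {α : Type*} (F : Set (Fact α)) : Fact α → Prop
  | .le t u => t = u ∨ .lt t u ∈ F ∨ ∃ m, .le t m ∈ F ∧ .le m u ∈ F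
  | .lt t u => (.le t u ∈ F ∧ .ne t u ∈ F) ∨ ∃ m, .lt t m ∈ F ∧ .le m u ∈ F
  | .ne _ _ => False

section Facts

variable {α D : Type*} [LinearOrder D] {v : α → D} {T : Set α} {F : Set (Fact α)} {f : Fact α}
  {op : CompOp} {l r : α}

theorem CompOp.over_asserts (hl : l ∈ T) (hr : r ∈ T) : ∀ f ∈ op.asserts l r, f.Over T := by
  cases op <;> simp [asserts, Fact.Over, hl, hr]

theorem CompOp.over_refutes (hl : l ∈ T) (hr : r ∈ T) : ∀ f ∈ op.refutes l r, f.Over T := by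
  cases op <;> simp [refutes, Fact.Over, hl, hr]

theorem CompOp.rel_iff_asserts : op.Rel (v l) (v r) ↔ ∀ f ∈ op.asserts l r, f.Holds v := by
  cases op <;> simp [asserts, Fact.Holds, Rel, le_antisymm_iff]

theorem CompOp.not_rel_iff_refutes (hop : op ≠ eq) :
    ¬ op.Rel (v l) (v r) ↔ ∀ f ∈ op.refutes l r, f.Holds v := by
  cases op <;> simp [refutes, Fact.Holds, Rel, le_antisymm_iff] at hop ⊢

theorem Comparison.holds_iff {ι : ℚ ↪o D} {h : ℕ → D} {e : Comparison} :
    e.Holds ι h ↔ e.op.Rel (h e.lhs) (e.rhs.value ι h) := by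
  obtain ⟨l, op, r⟩ := e
  cases op <;> rfl

theorem OrderStep.holds (hf : OrderStep F f) (hF : ∀ f ∈ F, f.Holds v) : f.Holds v := by
  cases f with
  | le t u =>
    rcases hf with rfl | h | ⟨m, h₁, h₂⟩
    · exact le_refl (v t)
    · exact (hF _ h).le
    · exact (hF _ h₁ : v t ≤ v m).trans (hF _ h₂)
  | lt t u =>
    rcases hf with ⟨h₁, h₂⟩ | ⟨m, h₁, h₂⟩
    · exact lt_of_le_of_ne (hF _ h₁) (hF _ h₂)
    · exact (hF _ h₁ : v t < v m).trans_le (hF _ h₂)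
  | ne t u => exact hf.elim

end Facts

/-! ### Models of consistent sets of facts -/

/-- The function `f` is monotone on `A` and takes equal values on equivalent elements only. -/
def IsFaithful {α E : Type*} [Preorder α] [LinearOrder E] (A : Finset α) (f : α → E) : Prop :=
  ∀ a ∈ A, ∀ b ∈ A, (a ≤ b → f a ≤ f b) ∧ (f a = f b → a ≤ b)

section Faithful

variable {α E : Type*} [Preorder α] [LinearOrder E] {A B : Finset α} {f : α → E} {t : α}

theorem IsFaithful.update [DecidableEq α] (hf : IsFaithful A f) (ht : t ∉ A) {q : E}
    (hq : ∀ b ∈ A, (t ≤ b → q ≤ f b) ∧ (q = f b → t ≤ b) ∧ (b ≤ t → f b ≤ q) ∧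
      (f b = q → b ≤ t)) :
    IsFaithful (insert t A) (Function.update f t q) := by
  have hA : ∀ b ∈ A, Function.update f t q b = f b :=
    fun b hb => Function.update_of_ne (ne_of_mem_of_not_mem hb ht) _ _
  intro a ha b hb
  rcases Finset.mem_insert.1 ha with ea | ha <;> rcases Finset.mem_insert.1 hb with eb | hb
  · simp [ea, eb]
  · rw [ea, Function.update_self, hA b hb]
    exact ⟨(hq b hb).1, (hq b hb).2.1⟩
  · rw [eb, Function.update_self, hA a ha]
    exact ⟨(hq a ha).2.2.1, (hq a ha).2.2.2⟩
  · rw [hA a ha, hA b hb]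
    exact hf a ha b hb

variable [DenselyOrdered E] [NoMinOrder E] [NoMaxOrder E] [Nonempty E]

/- The elements of `lo` are the values that lie weakly below the value of some `u ≤ t`, those of
`hi` are all others; a value strictly in between fits `t`. -/
open Classical in
theorem IsFaithful.exists_value_of_not_equiv (hf : IsFaithful A f)
    (ht : ∀ u ∈ A, t ≤ u → ¬ u ≤ t) :
    ∃ q, ∀ b ∈ A, q ≠ f b ∧ (t ≤ b → q ≤ f b) ∧ (b ≤ t → f b ≤ q) := by
  let Low (x : E) : Prop := ∃ u ∈ A, u ≤ t ∧ x ≤ f u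
  let lo := (A.image f).filter Low
  let hi := (A.image f).filter fun x => ¬ Low x
  have lo_lt_hi : ∀ x ∈ lo, ∀ y ∈ hi, x < y := by
    intro x hx y hy
    obtain ⟨-, u, hu, hut, hxu⟩ := Finset.mem_filter.1 hx
    by_contra hle
    exact (Finset.mem_filter.1 hy).2 ⟨u, hu, hut, (not_lt.1 hle).trans hxu⟩
  obtain ⟨q, hlo, hhi⟩ := Order.exists_between_finsets lo hi lo_lt_hi
  have lt_of_low : ∀ b ∈ A, Low (f b) → f b < q := fun b hb h =>
    hlo _ (Finset.mem_filter.2 ⟨Finset.mem_image_of_mem f hb, h⟩)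
  have gt_of_not_low : ∀ b ∈ A, ¬ Low (f b) → q < f b := fun b hb h =>
    hhi _ (Finset.mem_filter.2 ⟨Finset.mem_image_of_mem f hb, h⟩)
  refine ⟨q, fun b hb => ⟨?_, fun htb => (gt_of_not_low b hb ?_).le,
    fun hbt => (lt_of_low b hb ⟨b, hb, hbt, le_rfl⟩).le⟩⟩
  · by_cases h : Low (f b)
    · exact (lt_of_low b hb h).ne'
    · exact (gt_of_not_low b hb h).ne
  · rintro ⟨u, hu, hut, hbu⟩
    have hub : f u = f b := le_antisymm ((hf u hu b hb).1 (hut.trans htb)) hbu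
    exact ht b hb htb (((hf b hb u hu).2 hub.symm).trans hut)

theorem IsFaithful.exists_insert [DecidableEq α] (hf : IsFaithful A f) (ht : t ∉ A) :
    ∃ q, IsFaithful (insert t A) (Function.update f t q) := by
  by_cases hex : ∃ u ∈ A, t ≤ u ∧ u ≤ t
  · obtain ⟨u, hu, htu, hut⟩ := hex
    exact ⟨f u, hf.update ht fun b hb => ⟨fun h => (hf u hu b hb).1 (hut.trans h),
      fun h => htu.trans ((hf u hu b hb).2 h), fun h => (hf b hb u hu).1 (h.trans htu),
      fun h => ((hf b hb u hu).2 h).trans hut⟩⟩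
  · obtain ⟨q, hq⟩ := hf.exists_value_of_not_equiv fun u hu htu hut => hex ⟨u, hu, htu, hut⟩
    exact ⟨q, hf.update ht fun b hb => ⟨(hq b hb).2.1, fun h => absurd h (hq b hb).1,
      (hq b hb).2.2, fun h => absurd h.symm (hq b hb).1⟩⟩

theorem IsFaithful.exists_extension [DecidableEq α] (hf : IsFaithful A f) (B : Finset α) :
    ∃ g : α → E, IsFaithful (A ∪ B) g ∧ Set.EqOn g f A := by
  induction B using Finset.induction_on with
  | empty => exact ⟨f, by rwa [Finset.union_empty], fun _ _ => rfl⟩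
  | insert t B _ ih =>
    obtain ⟨g, hg, hgf⟩ := ih
    rw [Finset.union_insert]
    by_cases ht : t ∈ A ∪ B
    · exact ⟨g, by rwa [Finset.insert_eq_of_mem ht], hgf⟩
    · obtain ⟨q, hq⟩ := hg.exists_insert ht
      refine ⟨_, hq, fun a ha => ?_⟩
      have hat : a ≠ t := fun e => ht (e ▸ Finset.mem_union_left _ ha)
      rw [Function.update_of_ne hat, hgf ha]

end Faithful

/-- A set of facts about the terms in `T` that is closed under the rules for linear orders and
contains the comparisons of `Q` and the order of the constants in `T`. -/
structure Closed (Q : CQAC) (T : Set Term) (F : Set (Fact Term)) : Prop where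
  over_of_mem : ∀ f ∈ F, f.Over T
  order : ∀ f, f.Over T → OrderStep F f → f ∈ F
  lt_const : ∀ c d, .const c ∈ T → .const d ∈ T → c < d → .lt (.const c) (.const d) ∈ F
  comps : ∀ e ∈ Q.comps, ∀ f ∈ e.op.asserts (.var e.lhs) e.rhs, f ∈ F

section Model

variable {Q : CQAC} {T : Set Term} {F : Set (Fact Term)} {t u m : Term}

theorem Closed.le_trans (hF : Closed Q T F) (h₁ : .le t m ∈ F) (h₂ : .le m u ∈ F) :
    .le t u ∈ F :=
  hF.order _ ⟨(hF.over_of_mem _ h₁).1, (hF.over_of_mem _ h₂).2⟩ (Or.inr (Or.inr ⟨m, h₁, h₂⟩))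

theorem Closed.le_of_lt (hF : Closed Q T F) (h : .lt t u ∈ F) : .le t u ∈ F :=
  hF.order _ (hF.over_of_mem (.lt t u) h :) (Or.inr (Or.inl h))

theorem Closed.lt_of_lt_of_le (hF : Closed Q T F) (h₁ : .lt t m ∈ F) (h₂ : .le m u ∈ F) :
    .lt t u ∈ F :=
  hF.order _ ⟨(hF.over_of_mem _ h₁).1, (hF.over_of_mem _ h₂).2⟩ (Or.inr ⟨m, h₁, h₂⟩)

theorem Closed.lt_of_le_of_ne (hF : Closed Q T F) (h₁ : .le t u ∈ F) (h₂ : .ne t u ∈ F) :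
    .lt t u ∈ F :=
  hF.order _ (hF.over_of_mem (.le t u) h₁ :) (Or.inl ⟨h₁, h₂⟩)

theorem Closed.le_refl (hF : Closed Q T F) (ht : t ∈ T) : .le t t ∈ F :=
  hF.order _ ⟨ht, ht⟩ (Or.inl rfl)

/-- The terms in `T`, preordered by provable inequality. -/
abbrev Closed.preorder (hF : Closed Q T F) : Preorder T where
  le t u := .le t.1 u.1 ∈ F
  le_refl t := hF.le_refl t.2
  le_trans _ _ _ := hF.le_trans

/- Rational values suffice: the values of the constants are prescribed, and `ℚ` has room for those
of the other terms. -/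
open Classical in
theorem Closed.exists_rat_values {T : Finset Term} (hF : Closed Q T F)
    (hcons : ∀ t, .lt t t ∉ F) :
    ∃ v : T → ℚ, (∀ t u : T, (.le t.1 u.1 ∈ F → v t ≤ v u) ∧ (v t = v u → .le t.1 u.1 ∈ F)) ∧
      ∀ (c : ℚ) (hc : .const c ∈ T), v ⟨.const c, hc⟩ = c := by
  let _ := hF.preorder
  let constants : Finset T := Finset.univ.filter fun t => ∃ c, t.1 = .const c
  let v₀ : T → ℚ := fun t => match t.1 with
    | .var _ => 0
    | .const c => c
  have faithful : IsFaithful constants v₀ := by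
    rintro ⟨_, ht⟩ ht' ⟨_, hu⟩ hu'
    obtain ⟨-, c, rfl⟩ := Finset.mem_filter.1 ht'
    obtain ⟨-, d, rfl⟩ := Finset.mem_filter.1 hu'
    refine ⟨fun h => ?_, fun h => ?_⟩
    · by_contra hdc
      exact hcons _ (hF.lt_of_lt_of_le (hF.lt_const d c hu ht (not_le.1 hdc)) h)
    · obtain rfl : c = d := h
      exact hF.le_refl ht
  obtain ⟨v, hv, hv₀⟩ := faithful.exists_extension Finset.univ
  rw [Finset.union_eq_right.2 (Finset.subset_univ _)] at hv
  refine ⟨v, fun t u => hv t (Finset.mem_univ _) u (Finset.mem_univ _), fun c hc => ?_⟩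
  exact hv₀ (Finset.mem_coe.2 (Finset.mem_filter.2 ⟨Finset.mem_univ _, c, rfl⟩))

theorem Closed.exists_model {D : Type*} [LinearOrder D] (ι : ℚ ↪o D) {T : Finset Term}
    (hF : Closed Q T F) (hcons : ∀ t, .lt t t ∉ F) :
    ∃ h : ℕ → D, (∀ f ∈ F, f.Holds (Term.value ι h)) ∧
      ∀ t ∈ T, ∀ u ∈ T, t.value ι h = u.value ι h → .le t u ∈ F := by
  classical
  obtain ⟨v, hv, hconst⟩ := hF.exists_rat_values hcons
  let h : ℕ → D := fun x => if hx : .var x ∈ T then ι (v ⟨.var x, hx⟩) else ι 0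
  have hval : ∀ t : T, t.1.value ι h = ι (v t) := by
    rintro ⟨_ | c, ht⟩
    · exact dif_pos ht
    · rw [hconst c ht]
      rfl
  have hle : ∀ t u : T, .le t.1 u.1 ∈ F → v t ≤ v u := fun t u => (hv t u).1
  have hlt : ∀ t u : T, .lt t.1 u.1 ∈ F → v t < v u := fun t u H =>
    _root_.lt_of_le_of_ne (hle t u (hF.le_of_lt H)) fun e =>
      hcons t (hF.lt_of_lt_of_le H ((hv u t).2 e.symm))
  have hne : ∀ t u : T, .ne t.1 u.1 ∈ F → v t ≠ v u := fun t u H e =>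
    (hlt t u (hF.lt_of_le_of_ne ((hv t u).2 e) H)).ne e
  refine ⟨h, fun f hf => ?_, fun t ht u hu e => (hv ⟨t, ht⟩ ⟨u, hu⟩).2 (ι.injective ?_)⟩
  · obtain ⟨t, u⟩ | ⟨t, u⟩ | ⟨t, u⟩ := f <;> obtain ⟨ht, hu⟩ := hF.over_of_mem _ hf <;>
      simp only [Fact.Holds, hval ⟨t, ht⟩, hval ⟨u, hu⟩, ι.le_iff_le, ι.lt_iff_lt, ne_eq,
        ι.eq_iff_eq]
    exacts [hle ⟨t, ht⟩ ⟨u, hu⟩ hf, hlt ⟨t, ht⟩ ⟨u, hu⟩ hf, hne ⟨t, ht⟩ ⟨u, hu⟩ hf]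
  · rw [← hval ⟨t, ht⟩, ← hval ⟨u, hu⟩, e]

theorem compsHold_iff_asserts {D : Type*} [LinearOrder D] {ι : ℚ ↪o D} {h : ℕ → D} :
    Q.CompsHold ι h ↔ ∀ e ∈ Q.comps, ∀ f ∈ e.op.asserts (.var e.lhs) e.rhs,
      f.Holds (Term.value ι h) :=
  forall₂_congr fun _ _ => Comparison.holds_iff.trans
    (CompOp.rel_iff_asserts (v := Term.value ι h) (l := .var _))

end Model

/-! ### Applications of containment mappings -/

/-- The terms of a query. -/
def CQAC.terms (Q : CQAC) : List Term :=
  Q.head ++ Q.body.flatMap Atom.args ++ Q.comps.flatMap fun e => [Term.var e.lhs, e.rhs]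

open Classical in
/-- The terms of two queries: the facts of a proof of `Q₂ ⊑ Q₁` are about these. -/
noncomputable def pairTerms (Q₂ Q₁ : CQAC) : Finset Term := (Q₂.terms ++ Q₁.terms).toFinset

/-- Substitution of terms for the variables. -/
def Term.subst (γ : ℕ → Term) : Term → Term
  | var x => γ x
  | const c => const c

/-- The elements `t` and `u` are equal according to `F`. -/
def ProvEq {α : Type*} (F : Set (Fact α)) (t u : α) : Prop := .le t u ∈ F ∧ .le u t ∈ F

/-- The substitution `γ` represents the mapping `μ`, whose equations belong to `F`, and the fact `f`
is one of those that express the failure of the image of the remaining comparison. -/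
structure Applicable {Q₁ Q₂ : CQAC} (F : Set (Fact Term)) (μ : ContainmentMapping Q₁ Q₂)
    (γ : ℕ → Term) (f : Fact Term) : Prop where
  body : ∀ i, List.Forall₂ (fun t u => ProvEq F (t.subst γ) u) (Q₁.body.get i).args
    (Q₂.body.get (μ.toFun i)).args
  head : List.Forall₂ (fun t u => ProvEq F (t.subst γ) u) Q₁.head Q₂.head
  comps : ∀ e ∈ Q₁.comps, e.op = .eq ∧ ProvEq F (γ e.lhs) (e.rhs.subst γ) ∨
    f ∈ e.op.refutes (γ e.lhs) (e.rhs.subst γ)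

theorem CQAC.mem_terms_of_head {Q : CQAC} {t : Term} (h : t ∈ Q.head) : t ∈ Q.terms := by
  simp [terms, h]

theorem CQAC.mem_terms_of_body {Q : CQAC} {t : Term} {a : Atom} (ha : a ∈ Q.body)
    (h : t ∈ a.args) : t ∈ Q.terms := by
  simp only [terms, List.mem_append, List.mem_flatMap]
  exact Or.inl (Or.inr ⟨a, ha, h⟩)

theorem CQAC.mem_terms_of_comps {Q : CQAC} {e : Comparison} (he : e ∈ Q.comps) :
    .var e.lhs ∈ Q.terms ∧ e.rhs ∈ Q.terms := by
  simp only [terms, List.mem_append, List.mem_flatMap]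
  exact ⟨Or.inr ⟨e, he, by simp⟩, Or.inr ⟨e, he, by simp⟩⟩

theorem CQAC.occursIn_of_mem_terms {Q : CQAC} {x : ℕ} (h : .var x ∈ Q.terms) :
    OccursIn x Q.body := by
  simp only [terms, List.mem_append, List.mem_flatMap] at h
  rcases h with (h | ⟨a, ha, h⟩) | ⟨e, he, h⟩
  · exact Q.head_safe x h
  · exact ⟨a, ha, h⟩
  · rcases List.mem_pair.1 h with h | h
    · exact Term.var.inj h ▸ (Q.comps_safe e he).1
    · exact (Q.comps_safe e he).2 x h.symm

theorem mem_pairTerms_left {Q₂ Q₁ : CQAC} {t : Term} (h : t ∈ Q₂.terms) :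
    t ∈ pairTerms Q₂ Q₁ := by
  classical exact List.mem_toFinset.2 (List.mem_append_left _ h)

theorem mem_pairTerms_right {Q₂ Q₁ : CQAC} {t : Term} (h : t ∈ Q₁.terms) :
    t ∈ pairTerms Q₂ Q₁ := by
  classical exact List.mem_toFinset.2 (List.mem_append_right _ h)

theorem Comparison.isEquation_iff {e : Comparison} : e.isEquation = true ↔ e.op = .eq := by
  obtain ⟨l, op, r⟩ := e
  cases op <;> simp [isEquation]

theorem CQAC.HasOneAC.exists_unique {Q : CQAC} (hQ : Q.HasOneAC) :
    ∃ e₀ ∈ Q.comps, e₀.op ≠ .eq ∧ ∀ e ∈ Q.comps, e.op ≠ .eq → e = e₀ := by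
  obtain ⟨e₀, he₀⟩ := List.length_eq_one_iff.1 hQ
  have mem_iff : ∀ e, e ∈ Q.comps ∧ e.op ≠ .eq ↔ e = e₀ := fun e => by
    rw [← List.mem_singleton, ← he₀, List.mem_filter, Bool.not_eq_true', ← Bool.not_eq_true,
      Comparison.isEquation_iff]
  obtain ⟨hmem, hop⟩ := (mem_iff e₀).2 rfl
  exact ⟨e₀, hmem, hop, fun e he hop => (mem_iff e).1 ⟨he, hop⟩⟩

theorem forall₂_of_map_eq_map {α β δ : Type*} {R : α → β → Prop} {f : α → δ} {g : β → δ}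
    {l : List α} {l' : List β} (hR : ∀ a ∈ l, ∀ b ∈ l', f a = g b → R a b)
    (h : l.map f = l'.map g) : List.Forall₂ R l l' := by
  have hlen : l.length = l'.length := by simpa using congrArg List.length h
  refine List.forall₂_iff_get.2 ⟨hlen, fun i hi hi' =>
    hR _ (List.get_mem l ⟨i, hi⟩) _ (List.get_mem l' ⟨i, hi'⟩) ?_⟩
  have := List.getElem_of_eq h (by simpa using hi)
  rwa [List.getElem_map, List.getElem_map] at this

theorem map_eq_map_of_forall₂ {α β δ : Type*} {f : α → δ} {g : β → δ} {l : List α} {l' : List β}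
    (h : List.Forall₂ (fun a b => f a = g b) l l') : l.map f = l'.map g :=
  List.forall₂_eq_eq_eq ▸ List.forall₂_map_left_iff.2 (List.forall₂_map_right_iff.2 h)

section

variable {D : Type*} [LinearOrder D] {ι : ℚ ↪o D} {h g : ℕ → D} {Q₁ Q₂ : CQAC}
  {F : Set (Fact Term)} {μ : ContainmentMapping Q₁ Q₂} {γ : ℕ → Term} {f : Fact Term}

theorem Term.value_subst (t : Term) :
    (t.subst γ).value ι h = t.value ι fun x => (γ x).value ι h := by
  cases t <;> rfl

theorem ProvEq.value_eq {α : Type*} {v : α → D} {F : Set (Fact α)} {t u : α} (H : ProvEq F t u)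
    (hF : ∀ f ∈ F, f.Holds v) : v t = v u :=
  le_antisymm (hF _ H.1) (hF _ H.2)

theorem Applicable.matches (H : Applicable F μ γ f) (hF : ∀ f ∈ F, f.Holds (Term.value ι h)) :
    μ.Matches ι h fun x => (γ x).value ι h :=
  have hval : ∀ t u : Term, ProvEq F (t.subst γ) u →
      t.value ι (fun x => (γ x).value ι h) = u.value ι h :=
    fun t _ e => (Term.value_subst t).symm.trans (e.value_eq hF)
  ⟨fun i => map_eq_map_of_forall₂ ((H.body i).imp hval),
    map_eq_map_of_forall₂ (H.head.imp hval)⟩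

theorem Applicable.equation_holds (H : Applicable F μ γ f)
    (hF : ∀ f ∈ F, f.Holds (Term.value ι h)) {e : Comparison} (he : e ∈ Q₁.comps)
    (hop : e.op = .eq) : e.Holds ι fun x => (γ x).value ι h := by
  rw [Comparison.holds_iff, hop]
  rcases H.comps e he with ⟨-, heq⟩ | hf
  · exact (heq.value_eq hF).trans (Term.value_subst e.rhs)
  · simp [hop, CompOp.refutes] at hf

theorem Applicable.equationsHold (H : Applicable F μ γ f)
    (hF : ∀ f ∈ F, f.Holds (Term.value ι h)) : μ.EquationsHold ι h :=
  ⟨_, H.matches hF, fun _ he hop => H.equation_holds hF he (Comparison.isEquation_iff.1 hop)⟩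

theorem Applicable.holds (H : Applicable F μ γ f) (hF : ∀ f ∈ F, f.Holds (Term.value ι h))
    (hμ : ¬ μ.CompsHold ι h) : f.Holds (Term.value ι h) := by
  by_contra hf
  refine hμ ⟨_, H.matches hF, fun e he => ?_⟩
  by_cases hop : e.op = .eq
  · exact H.equation_holds hF he hop
  · have hfe := (H.comps e he).resolve_left fun h => hop h.1
    rw [Comparison.holds_iff, ← Term.value_subst]
    by_contra hn
    exact hf ((CompOp.not_rel_iff_refutes hop).1 hn f hfe)

theorem ContainmentMapping.Matches.exists_term (hm : μ.Matches ι h g) {x : ℕ}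
    (hx : OccursIn x Q₁.body) : ∃ u ∈ Q₂.terms, u.value ι h = g x := by
  obtain ⟨a, ha, hax⟩ := hx
  obtain ⟨i, rfl⟩ := List.get_of_mem ha
  have : g x ∈ (Q₁.body.get i).args.map (Term.value ι g) := List.mem_map_of_mem hax
  rw [hm.1 i] at this
  obtain ⟨u, hu, hval⟩ := List.mem_map.1 this
  exact ⟨u, CQAC.mem_terms_of_body (List.get_mem _ _) hu, hval⟩

theorem ContainmentMapping.Matches.exists_subst (hm : μ.Matches ι h g) :
    ∃ γ : ℕ → Term, ∀ t ∈ Q₁.terms,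
      (t.subst γ).value ι h = t.value ι g ∧ t.subst γ ∈ pairTerms Q₂ Q₁ := by
  have : ∀ x, ∃ u, OccursIn x Q₁.body → u ∈ Q₂.terms ∧ u.value ι h = g x := fun x => by
    by_cases hx : OccursIn x Q₁.body
    · exact (hm.exists_term hx).imp fun _ hu _ => hu
    · exact ⟨.var 0, fun h => absurd h hx⟩
  choose γ hγ using this
  refine ⟨γ, fun t ht => ?_⟩
  cases t with
  | var x =>
    obtain ⟨hmem, hval⟩ := hγ x (CQAC.occursIn_of_mem_terms ht)
    exact ⟨hval, mem_pairTerms_left hmem⟩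
  | const c => exact ⟨rfl, mem_pairTerms_right ht⟩

theorem contained_iff : Contained ι Q₂ Q₁ ↔
    ∀ h, Q₂.CompsHold ι h → ∃ μ : ContainmentMapping Q₁ Q₂, μ.CompsHold ι h := by
  constructor
  · intro hc h hh
    let canonical := Q₂.body.map fun a => (a.rel, a.args.map (Term.value ι h))
    obtain ⟨g, hbody, hcomps, hhead⟩ := hc {x | x ∈ canonical} (List.finite_toSet _)
      ⟨h, fun a ha => List.mem_map.2 ⟨a, ha, rfl⟩, hh, rfl⟩
    have himage : ∀ i : Fin Q₁.body.length, ∃ j : Fin Q₂.body.length,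
        (Q₁.body.get i).rel = (Q₂.body.get j).rel ∧
        (Q₁.body.get i).args.map (Term.value ι g) = (Q₂.body.get j).args.map (Term.value ι h) := by
      intro i
      obtain ⟨b, hb, e⟩ := List.mem_map.1 (hbody _ (List.get_mem _ i))
      obtain ⟨j, rfl⟩ := List.get_of_mem hb
      exact ⟨j, (Prod.mk.inj e).1.symm, (Prod.mk.inj e).2.symm⟩
    choose m hrel hargs using himage
    exact ⟨⟨m, hrel, fun i => by simpa using congrArg List.length (hargs i)⟩, g,
      ⟨hargs, hhead.symm⟩, hcomps⟩
  · rintro H I - _ ⟨h, hbody, hcomps, rfl⟩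
    obtain ⟨μ, g, ⟨hm, hhead⟩, hg⟩ := H h hcomps
    refine ⟨g, fun a ha => ?_, hg, hhead.symm⟩
    obtain ⟨i, rfl⟩ := List.get_of_mem ha
    rw [μ.rel_eq, hm]
    exact hbody _ (List.get_mem _ _)

theorem Applicable.of_matches (hm : μ.Matches ι h g) {e₀ : Comparison}
    (hunique : ∀ e ∈ Q₁.comps, e.op ≠ .eq → e = e₀) (hg : Q₁.CompsHold ι g)
    (hγ : ∀ t ∈ Q₁.terms, (t.subst γ).value ι h = t.value ι g ∧ t.subst γ ∈ pairTerms Q₂ Q₁)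
    (hinj : ∀ t ∈ pairTerms Q₂ Q₁, ∀ u ∈ pairTerms Q₂ Q₁, t.value ι h = u.value ι h → .le t u ∈ F)
    (hf : f ∈ e₀.op.refutes (γ e₀.lhs) (e₀.rhs.subst γ)) : Applicable F μ γ f := by
  have provEq : ∀ t ∈ Q₁.terms, ∀ u ∈ pairTerms Q₂ Q₁, t.value ι g = u.value ι h →
      ProvEq F (t.subst γ) u := fun t ht u hu e =>
    have e' := (hγ t ht).1.trans e
    ⟨hinj _ (hγ t ht).2 _ hu e', hinj _ hu _ (hγ t ht).2 e'.symm⟩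
  refine ⟨fun i => forall₂_of_map_eq_map (fun t ht u hu => ?_) (hm.1 i),
    forall₂_of_map_eq_map (fun t ht u hu => ?_) hm.2, fun e he => ?_⟩
  · exact provEq t (CQAC.mem_terms_of_body (List.get_mem _ _) ht) u
      (mem_pairTerms_left (CQAC.mem_terms_of_body (List.get_mem _ _) hu))
  · exact provEq t (CQAC.mem_terms_of_head ht) u (mem_pairTerms_left (CQAC.mem_terms_of_head hu))
  · by_cases hop : e.op = .eq
    · obtain ⟨hl, hr⟩ := CQAC.mem_terms_of_comps he
      have heq := Comparison.holds_iff.1 (hg e he)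
      rw [hop] at heq
      exact Or.inl ⟨hop, provEq _ hl _ (hγ _ hr).2 (heq.trans (hγ _ hr).1.symm)⟩
    · exact Or.inr (hunique e he hop ▸ hf)

/- In a model of a consistent closed set `F` that identifies provably equal terms only, containment
yields a containment mapping all of whose comparisons are true; the mapping is then applicable to
`F`, but the fact that it produces is false. -/
theorem Closed.exists_lt_self_mem (hc : Contained ι Q₂ Q₁) (hQ₁ : Q₁.HasOneAC)
    (hF : Closed Q₂ (pairTerms Q₂ Q₁) F)
    (happ : ∀ (μ : ContainmentMapping Q₁ Q₂) (γ : ℕ → Term) (f : Fact Term), Applicable F μ γ f →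
      (∀ t ∈ Q₁.terms, t.subst γ ∈ pairTerms Q₂ Q₁) → f.Over (pairTerms Q₂ Q₁ : Set Term) →
        f ∈ F) :
    ∃ t, .lt t t ∈ F := by
  by_contra! hcons
  obtain ⟨h, hmodel, hinj⟩ := hF.exists_model ι hcons
  obtain ⟨μ, g, hm, hg⟩ := contained_iff.1 hc h
    (compsHold_iff_asserts.2 fun e he f hf => hmodel f (hF.comps e he f hf))
  obtain ⟨γ, hγ⟩ := hm.exists_subst
  obtain ⟨e₀, he₀, hop, hunique⟩ := hQ₁.exists_unique
  obtain ⟨hl, hr⟩ := CQAC.mem_terms_of_comps he₀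
  have hrel : e₀.op.Rel ((γ e₀.lhs).value ι h) ((e₀.rhs.subst γ).value ι h) := by
    rw [(hγ _ hr).1, show (γ e₀.lhs).value ι h = g e₀.lhs from (hγ _ hl).1]
    exact Comparison.holds_iff.1 (hg e₀ he₀)
  obtain ⟨f, hf, hfalse⟩ : ∃ f ∈ e₀.op.refutes (γ e₀.lhs) (e₀.rhs.subst γ),
      ¬ f.Holds (Term.value ι h) := by
    by_contra! hall
    exact (CompOp.not_rel_iff_refutes hop).2 hall hrel
  exact hfalse (hmodel f (happ μ γ f (.of_matches hm hunique hg hγ hinj hf)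
    (fun t ht => (hγ t ht).2) (CompOp.over_refutes (hγ _ hl).2 (hγ _ hr).2 f hf)))

end

theorem exists_saturated {α : Type*} [DecidableEq α] (S : Finset α) {P : Finset α → Prop}
    (h : P ∅) : ∃ A ⊆ S, P A ∧ ∀ a ∈ S, P (insert a A) → a ∈ A := by
  classical
  obtain ⟨A, hA, hmax⟩ := (S.powerset.filter P).exists_max_image Finset.card
    ⟨∅, by simp [h]⟩
  rw [Finset.mem_filter, Finset.mem_powerset] at hA
  refine ⟨A, hA.1, hA.2, fun a ha hP => ?_⟩
  have hle := hmax (insert a A) (by simp [hP, Finset.insert_subset ha hA.1])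
  by_contra hmem
  rw [Finset.card_insert_of_notMem hmem] at hle
  omega

open Classical in
/-- The facts about the elements of a finite set. -/
noncomputable def factsOver {α : Type*} (T : Finset α) : Finset (Fact α) :=
  Finset.image₂ .le T T ∪ Finset.image₂ .lt T T ∪ Finset.image₂ .ne T T

theorem mem_factsOver {α : Type*} {T : Finset α} {f : Fact α} :
    f ∈ factsOver T ↔ f.Over (T : Set α) := by
  cases f <;> simp [factsOver, Fact.Over]

theorem card_factsOver_le {α : Type*} (T : Finset α) : (factsOver T).card ≤ 3 * T.card ^ 2 := by
  classical
  rw [show 3 * T.card ^ 2 = T.card * T.card + T.card * T.card + T.card * T.card by ring]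
  exact (Finset.card_union_le _ _).trans (Nat.add_le_add ((Finset.card_union_le _ _).trans
    (Nat.add_le_add (Finset.card_image₂_le _ _ _) (Finset.card_image₂_le _ _ _)))
      (Finset.card_image₂_le _ _ _))

/-! ### Certifying lists of mappings -/

section

variable {D : Type*} [LinearOrder D] {ι : ℚ ↪o D} {Q₁ Q₂ : CQAC}
  {L : List (ContainmentMapping Q₁ Q₂)} {μ : ContainmentMapping Q₁ Q₂}

/-- The facts that follow from the comparisons of `Q₂` and the failure of the mappings of `L`. -/
def entailed (ι : ℚ ↪o D) (L : List (ContainmentMapping Q₁ Q₂)) : Set (Fact Term) :=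
  {f | ∀ h : ℕ → D, Q₂.CompsHold ι h → (∀ μ ∈ L, ¬ μ.CompsHold ι h) → f.Holds (Term.value ι h)}

/-- The equations of each mapping of the list follow from the comparisons of `Q₂` and the failure
of the preceding mappings. -/
def IsOrdered (ι : ℚ ↪o D) (L : List (ContainmentMapping Q₁ Q₂)) : Prop :=
  ∀ j : Fin L.length, ∀ h : ℕ → D, Q₂.CompsHold ι h →
    (∀ i : Fin L.length, i < j → ¬ (L.get i).CompsHold ι h) → (L.get j).EquationsHold ι h

theorem entailed_subset_append : entailed ι L ⊆ entailed ι (L ++ [μ]) :=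
  fun _ hf h hh hL => hf h hh fun ν hν => hL ν (List.mem_append_left _ hν)

theorem IsOrdered.append (hL : IsOrdered ι L)
    (hμ : ∀ h, Q₂.CompsHold ι h → (∀ ν ∈ L, ¬ ν.CompsHold ι h) → μ.EquationsHold ι h) :
    IsOrdered ι (L ++ [μ]) := by
  rintro ⟨j, hj⟩ h hh hlt
  have hlt' : ∀ (i : ℕ) (hi : i < L.length), i < j → ¬ (L.get ⟨i, hi⟩).CompsHold ι h := by
    intro i hi hij
    have := hlt ⟨i, by rw [List.length_append]; omega⟩ hij
    rwa [List.get_eq_getElem, List.getElem_append_left hi] at this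
  rw [List.length_append, List.length_singleton, Nat.lt_succ_iff_lt_or_eq] at hj
  rcases hj with hj | rfl
  · rw [List.get_eq_getElem, List.getElem_append_left hj]
    exact hL ⟨j, hj⟩ h hh fun i hi => hlt' i i.2 hi
  · rw [List.get_eq_getElem, List.getElem_concat_length rfl]
    refine hμ h hh fun ν hν => ?_
    obtain ⟨i, rfl⟩ := List.get_of_mem hν
    exact hlt' i i.2 i.2

theorem closed_of_mem_of_entailed {T : Set Term} {A : Set (Fact Term)}
    (hA : A ⊆ entailed ι L) (hover : ∀ f ∈ A, f.Over T)
    (hmem : ∀ f ∈ entailed ι L, f.Over T → f ∈ A) (hT : ∀ t ∈ Q₂.terms, t ∈ T) :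
    Closed Q₂ T A where
  over_of_mem := hover
  order f hf hstep := hmem f (fun h hh hL => hstep.holds fun _ hf => hA hf h hh hL) hf
  lt_const _ _ hc hd hcd := hmem _ (fun _ _ _ => ι.lt_iff_lt.2 hcd) ⟨hc, hd⟩
  comps e he f hf :=
    hmem f (fun _ hh _ => compsHold_iff_asserts.1 hh e he f hf)
      (CompOp.over_asserts (hT _ (CQAC.mem_terms_of_comps he).1)
        (hT _ (CQAC.mem_terms_of_comps he).2) f hf)

/- Take a largest set of facts over the terms of the queries such that some ordered list, no longer
than the set is large, entails it. -/
theorem exists_certifies (hc : Contained ι Q₂ Q₁) (hQ₁ : Q₁.HasOneAC) :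
    ∃ L : List (ContainmentMapping Q₁ Q₂),
      L.length ≤ 3 * (pairTerms Q₂ Q₁).card ^ 2 ∧ Certifies ι L := by
  classical
  obtain ⟨A, hAS, ⟨L, hL, hlen, hA⟩, hsat⟩ := exists_saturated (factsOver (pairTerms Q₂ Q₁))
    (P := fun A => ∃ L : List (ContainmentMapping Q₁ Q₂), IsOrdered ι L ∧ L.length ≤ A.card ∧
      ↑A ⊆ entailed ι L) ⟨[], fun j => j.elim0, le_rfl, by simp⟩
  refine ⟨L, hlen.trans ((Finset.card_le_card hAS).trans (card_factsOver_le _)), hL,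
    fun h hh => ?_⟩
  have hclosed : Closed Q₂ (pairTerms Q₂ Q₁) (A : Set (Fact Term)) :=
    closed_of_mem_of_entailed hA (fun f hf => mem_factsOver.1 (hAS hf))
      (fun f hf hover => hsat f (mem_factsOver.2 hover)
        ⟨L, hL, hlen.trans (Finset.card_le_card (Finset.subset_insert _ _)),
          by rw [Finset.coe_insert]; exact Set.insert_subset hf hA⟩)
      fun t => mem_pairTerms_left
  obtain ⟨t, ht⟩ := hclosed.exists_lt_self_mem hc hQ₁ fun μ γ f happ _ hover => by
    by_contra hf
    refine hf (hsat f (mem_factsOver.2 hover) ⟨L ++ [μ], hL.append fun h hh hno =>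
      happ.equationsHold fun f hf => hA hf h hh hno, ?_, ?_⟩)
    · rw [Finset.card_insert_of_notMem hf]
      simpa using hlen
    · rw [Finset.coe_insert]
      refine Set.insert_subset (fun h hh hno => ?_) (hA.trans entailed_subset_append)
      exact happ.holds (fun f hf => hA hf h hh fun ν hν => hno ν (List.mem_append_left _ hν))
        (hno μ (by simp))
  by_contra! hno
  exact lt_irrefl _ (hA ht h hh hno)

theorem Certifies.contained (hL : Certifies ι L) : Contained ι Q₂ Q₁ :=
  contained_iff.2 fun h hh => let ⟨μ, _, hμ⟩ := hL.2 h hh; ⟨μ, hμ⟩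

end

/-! ### Derivations and their soundness -/

/-- A line of a derivation. Facts are about codes of terms. A code `γ` of a substitution is a list
of pairs of codes of terms, and `matching γ l l'` says that `γ` sends the list `l` to the
list `l'`. The lines `add c x y z` and `mul x y z` say that `c + x + y = z`, where `c` is a single
digit, and `x * y = z` for numbers in binary. -/
inductive Line where
  | fact (f : Fact Tree)
  | matching (γ l l' : Tree)
  | add (c x y z : Tree)
  | mul (x y z : Tree)

namespace Line

/-- The tree that stands for a line in a certificate. -/
def encode : Line → Tree
  | fact (.le t u) => .cons (.ofNat 0) (.cons t u)
  | fact (.lt t u) => .cons (.ofNat 1) (.cons t u)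
  | fact (.ne t u) => .cons (.ofNat 2) (.cons t u)
  | matching γ l l' => .cons (.ofNat 3) (.cons γ (.cons l l'))
  | add c x y z => .cons (.ofNat 4) (.cons c (.cons x (.cons y z)))
  | mul x y z => .cons (.ofNat 5) (.cons x (.cons y z))

/-- The truth of a line when coded terms have the values `v`. -/
def Holds {D : Type*} [LinearOrder D] (v : Tree → D) : Line → Prop
  | fact f => f.Holds v
  | matching γ l l' => ∀ w : Tree → D, (∀ r ∈ γ.toList, w r.hd = v r.tl) →
      l.toList.map w = l'.toList.map v
  | add c x y z => c.digit + x.num + y.num = z.num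
  | mul x y z => x.num * y.num = z.num

end Line

/-- The fact is one of those asserted by the comparisons of the query with code `q`. -/
def ComparisonStep (q : Tree) (f : Fact Tree) : Prop :=
  ∃ e ∈ q.tl.tl.toList, ∃ op : CompOp, e.hd = op.encode ∧
    f ∈ op.asserts (Tree.cons (Tree.ofBool false) e.tl.hd) e.tl.tl

/-- The lines `p` contain a computation showing `a * b < c * d`. -/
def MulLt (p : Set Line) (a b c d : Tree) : Prop :=
  ∃ m, .mul a b m ∈ p ∧ ∃ n, .mul c d n ∈ p ∧ ∃ k, .add (Tree.ofBool true) m k n ∈ p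

/-- The lines `p` contain a computation showing that one rational number is less than another; the
components of `r` are sign, numerator and denominator. -/
def RatLt (p : Set Line) (r s : Tree) : Prop :=
  r.tl.tl.num ≠ 0 ∧ s.tl.tl.num ≠ 0 ∧
    (r.hd ≠ .nil ∧ s.hd = .nil ∧ r.tl.hd.num ≠ 0 ∨
      r.hd = .nil ∧ s.hd = .nil ∧ MulLt p r.tl.hd s.tl.tl s.tl.hd r.tl.tl ∨
      r.hd ≠ .nil ∧ s.hd ≠ .nil ∧ MulLt p s.tl.hd r.tl.tl r.tl.hd s.tl.tl)

/-- The fact is an inequality between constants that `p` contains a computation for. -/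
def ConstStep (p : Set Line) : Fact Tree → Prop
  | .lt t u => t.hd ≠ .nil ∧ u.hd ≠ .nil ∧ RatLt p t.tl u.tl
  | _ => False

/-- The list of pairs `γ` is the graph of a function that leaves constants fixed. -/
def IsSubst (γ : Tree) : Prop :=
  (∀ r ∈ γ.toList, ∀ r' ∈ γ.toList, r.hd = r'.hd → r.tl = r'.tl) ∧
    ∀ r ∈ γ.toList, r.hd.hd ≠ .nil → r.tl = r.hd

/-- The comparison with code `e` is an equation whose image under `γ` belongs to `F`, or `f` is one
of the facts that express the failure of its image. -/
def EquationOrRefuted (F : Set (Fact Tree)) (γ e : Tree) (f : Fact Tree) : Prop :=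
  ∃ l ∈ γ.toList, ∃ r ∈ γ.toList, l.hd = .cons (Tree.ofBool false) e.tl.hd ∧ r.hd = e.tl.tl ∧
    ∃ op : CompOp, e.hd = op.encode ∧
      (op = .eq ∧ ProvEq F l.tl r.tl ∨ f ∈ op.refutes l.tl r.tl)

/-- Some containment mapping has equations that are among the lines `p`, and `f` is one of the facts
that express the failure of the image of the remaining comparison. -/
def MappingStep (q₂ q₁ : Tree) (p : Set Line) (f : Fact Tree) : Prop :=
  ∃ γ, .matching γ q₁.hd q₂.hd ∈ p ∧ IsSubst γ ∧
    (∀ a ∈ q₁.tl.hd.toList, ∃ b ∈ q₂.tl.hd.toList, a.hd = b.hd ∧ .matching γ a.tl b.tl ∈ p) ∧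
    ∀ e ∈ q₁.tl.tl.toList, EquationOrRefuted (Line.fact ⁻¹' p) γ e f

/-- The line follows in one step from the lines `p`, where `q₂` and `q₁` are the codes of two
queries: under the assumptions that the comparisons of `Q₂` are true and that no containment mapping
makes all comparisons of `Q₁` true. -/
def Justified (q₂ q₁ : Tree) (p : Set Line) : Line → Prop
  | .fact f => OrderStep (Line.fact ⁻¹' p) f ∨ ComparisonStep q₂ f ∨ ConstStep p f ∨
      MappingStep q₂ q₁ p f
  | .matching γ l l' => l = .nil ∧ l' = .nil ∨ l ≠ .nil ∧ l' ≠ .nil ∧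
      .matching γ l.tl l'.tl ∈ p ∧
        ∃ r ∈ γ.toList, r.hd = l.hd ∧ ProvEq (Line.fact ⁻¹' p) r.tl l'.hd
  | .add c x y z => (c = .nil ∧ x = .nil ∧ y = .nil ∧ z = .nil) ∨
      ∃ c', .add c' x.tl y.tl z.tl ∈ p ∧
        c.digit + x.hd.digit + y.hd.digit = z.hd.digit + 2 * c'.digit
  | .mul x y z => (x = .nil ∧ z = .nil) ∨
      ∃ m, .mul x.tl y m ∈ p ∧ (x.hd = .nil ∧ .add .nil (.cons .nil m) .nil z ∈ p ∨
        x.hd ≠ .nil ∧ .add .nil (.cons .nil m) y z ∈ p)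

/-- The lines whose codes occur in a list. -/
def coded (s : Tree) : Set Line := {m | m.encode ∈ s.toList}

/-- The list of lines `y`, the last one coming first, is a derivation of a contradiction. -/
def IsRefutation (q₂ q₁ y : Tree) : Prop :=
  (∀ s ∈ y.suffixes, ∃ m : Line, s.hd = m.encode ∧ Justified q₂ q₁ (coded s.tl) m) ∧
    ∃ t, .fact (.lt t t) ∈ coded y

theorem Line.encode_injective : Function.Injective Line.encode := by
  rintro (⟨⟨⟩ | ⟨⟩ | ⟨⟩⟩ | _ | _ | _) (⟨⟨⟩ | ⟨⟩ | ⟨⟩⟩ | _ | _ | _) h <;>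
    simp [encode, Tree.ofNat_injective.eq_iff] at h ⊢ <;> simp [h]

theorem CompOp.encode_injective : Function.Injective CompOp.encode := by
  intro a b h
  cases a <;> cases b <;> simp [encode, Tree.ofNat_injective.eq_iff] at h ⊢

theorem IsSubst.exists_value {α : Type*} {γ : Tree} (hγ : IsSubst γ) (v : Tree → α) :
    ∃ w : Tree → α, (∀ r ∈ γ.toList, w r.hd = v r.tl) ∧ ∀ t : Tree, t.hd ≠ .nil → w t = v t := by
  classical
  let w : Tree → α := fun t => if H : ∃ r ∈ γ.toList, r.hd = t then v H.choose.tl else v t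
  have hw : ∀ r ∈ γ.toList, w r.hd = v r.tl := by
    intro r hr
    have H : ∃ r' ∈ γ.toList, r'.hd = r.hd := ⟨r, hr, rfl⟩
    rw [show w r.hd = v H.choose.tl from dif_pos H,
      hγ.1 _ H.choose_spec.1 r hr H.choose_spec.2]
  refine ⟨w, hw, fun t ht => ?_⟩
  by_cases H : ∃ r ∈ γ.toList, r.hd = t
  · obtain ⟨r, hr, rfl⟩ := H
    rw [hw r hr, hγ.2 r hr ht]
  · exact dif_neg H

section Soundness

variable {D : Type*} [LinearOrder D] {v : Tree → D} {p : Set Line} {f : Fact Tree}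

theorem MulLt.lt {a b c d : Tree} (H : MulLt p a b c d) (hp : ∀ m ∈ p, m.Holds v) :
    a.num * b.num < c.num * d.num := by
  obtain ⟨m, hm, n, hn, k, hk⟩ := H
  have hm : a.num * b.num = m.num := hp _ hm
  have hn : c.num * d.num = n.num := hp _ hn
  have hk : 1 + m.num + k.num = n.num := hp _ hk
  omega

theorem RatLt.lt {r s : Tree} (H : RatLt p r s) (hp : ∀ m ∈ p, m.Holds v) : r.rat < s.rat := by
  obtain ⟨hr, hs, H⟩ := H
  have hr : (0 : ℚ) < r.tl.tl.num := Nat.cast_pos.2 (Nat.pos_of_ne_zero hr)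
  have hs : (0 : ℚ) < s.tl.tl.num := Nat.cast_pos.2 (Nat.pos_of_ne_zero hs)
  unfold Tree.rat
  rw [div_lt_div_iff₀ hr hs]
  rcases H with ⟨h₁, h₂, hnum⟩ | ⟨h₁, h₂, hlt⟩ | ⟨h₁, h₂, hlt⟩
  · have hnum : (0 : ℚ) < r.tl.hd.num := Nat.cast_pos.2 (Nat.pos_of_ne_zero hnum)
    rw [if_neg (Tree.digit_eq_zero.not.2 h₁), if_pos (Tree.digit_eq_zero.2 h₂)]
    nlinarith [mul_pos hnum hs, mul_nonneg (Nat.cast_nonneg (α := ℚ) s.tl.hd.num) hr.le]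
  · rw [if_pos (Tree.digit_eq_zero.2 h₁), if_pos (Tree.digit_eq_zero.2 h₂)]
    exact_mod_cast hlt.lt hp
  · rw [if_neg (Tree.digit_eq_zero.not.2 h₁), if_neg (Tree.digit_eq_zero.not.2 h₂),
      neg_mul, neg_mul, neg_lt_neg_iff]
    exact_mod_cast hlt.lt hp

variable {ι : ℚ ↪o D} {h : ℕ → D} {Q₂ Q₁ : CQAC}

/-- The value of a term that is given by its code. -/
noncomputable def codeValue (ι : ℚ ↪o D) (h : ℕ → D) (t : Tree) : D :=
  if t.hd.digit = 0 then h t.tl.num else ι t.tl.rat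

theorem codeValue_encode (t : Term) : codeValue ι h t.encode = t.value ι h := by
  cases t with
  | var x => simp [codeValue, Term.encode, Tree.ofBool, Tree.digit, Term.value, Tree.num_ofNat]
  | const c => simp [codeValue, Term.encode, Tree.ofBool, Tree.digit, Term.value, Tree.rat_ofRat]

theorem mem_toList_ofList_map {α : Type*} {enc : α → Tree} {l : List α} {t : Tree} :
    t ∈ (Tree.ofList (l.map enc)).toList ↔ ∃ a ∈ l, enc a = t := by
  rw [Tree.toList_ofList, List.mem_map]

theorem ComparisonStep.holds (hf : ComparisonStep Q₂.encode f) (hQ₂ : Q₂.CompsHold ι h) :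
    f.Holds (codeValue ι h) := by
  obtain ⟨c, hc, op, hop, hf⟩ := hf
  obtain ⟨e, he, rfl⟩ := mem_toList_ofList_map.1 hc
  obtain rfl := CompOp.encode_injective hop
  refine (CompOp.rel_iff_asserts (l := (Term.var e.lhs).encode)).1 ?_ f hf
  rw [codeValue_encode]
  exact (codeValue_encode (ι := ι) (h := h) e.rhs).symm ▸ Comparison.holds_iff.1 (hQ₂ e he)

theorem ConstStep.holds (hf : ConstStep p f) (hp : ∀ m ∈ p, m.Holds (codeValue ι h)) :
    f.Holds (codeValue ι h) := by
  match f, hf with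
  | .lt t u, ⟨ht, hu, hlt⟩ =>
    change codeValue ι h t < codeValue ι h u
    rw [codeValue, codeValue, if_neg (Tree.digit_eq_zero.not.2 ht),
      if_neg (Tree.digit_eq_zero.not.2 hu), ι.lt_iff_lt]
    exact hlt.lt hp

theorem EquationOrRefuted.holds {e : Comparison} {γ : Tree} {k : ℕ → D} {w : Tree → D}
    (H : EquationOrRefuted (Line.fact ⁻¹' p) γ e.encode f) (hp : ∀ m ∈ p, m.Holds v)
    (hf : ¬ f.Holds v) (hγ : ∀ r ∈ γ.toList, w r.hd = v r.tl)
    (hw : ∀ t : Term, w t.encode = t.value ι k) : e.Holds ι k := by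
  obtain ⟨l, hl, r, hr, el, er, op, hop, H⟩ := H
  obtain rfl := CompOp.encode_injective hop
  have hlhs : v l.tl = k e.lhs := by
    rw [← hγ l hl, el]
    exact hw (.var e.lhs)
  have hrhs : v r.tl = e.rhs.value ι k := by
    rw [← hγ r hr, er]
    exact hw e.rhs
  rw [Comparison.holds_iff, ← hlhs, ← hrhs]
  rcases H with ⟨hop, heq⟩ | hmem
  · rw [hop]
    exact heq.value_eq fun g hg => hp _ hg
  · by_contra hn
    have hop : e.op ≠ .eq := fun h => by simp [h, CompOp.refutes] at hmem
    exact hf ((CompOp.not_rel_iff_refutes hop).1 hn f hmem)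

/- If `f` were false, then the substitution together with the choice of atoms would be a containment
mapping that makes all comparisons of `Q₁` true. -/
theorem MappingStep.holds (hf : MappingStep Q₂.encode Q₁.encode p f)
    (hp : ∀ m ∈ p, m.Holds (codeValue ι h))
    (hQ : ∀ μ : ContainmentMapping Q₁ Q₂, ¬ μ.CompsHold ι h) : f.Holds (codeValue ι h) := by
  by_contra hfalse
  obtain ⟨γ, hhead, hγ, hbody, hcomps⟩ := hf
  obtain ⟨w, hwγ, hwconst⟩ := hγ.exists_value (codeValue ι h)
  let g : ℕ → D := fun x => w (Term.var x).encode
  have hw : ∀ t : Term, w t.encode = t.value ι g := by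
    rintro (x | c)
    · rfl
    · rw [hwconst _ (by simp [Term.encode, Tree.ofBool]), codeValue_encode]
      rfl
  have hmatch : ∀ l l' : List Term,
      .matching γ (.ofList (l.map Term.encode)) (.ofList (l'.map Term.encode)) ∈ p →
      l.map (Term.value ι g) = l'.map (Term.value ι h) := by
    intro l l' hl
    simpa [Function.comp_def, hw, codeValue_encode] using hp _ hl w hwγ
  have himage : ∀ i : Fin Q₁.body.length, ∃ j : Fin Q₂.body.length,
      (Q₁.body.get i).rel = (Q₂.body.get j).rel ∧
      (Q₁.body.get i).args.map (Term.value ι g) = (Q₂.body.get j).args.map (Term.value ι h) := by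
    intro i
    obtain ⟨b, hb, hrel, hargs⟩ := hbody _ (mem_toList_ofList_map.2 ⟨_, List.get_mem _ i, rfl⟩)
    obtain ⟨a, ha, rfl⟩ := mem_toList_ofList_map.1 hb
    obtain ⟨j, rfl⟩ := List.get_of_mem ha
    exact ⟨j, Tree.ofNat_injective hrel, hmatch _ _ hargs⟩
  choose m hrel hargs using himage
  refine hQ ⟨m, hrel, fun i => by simpa using congrArg List.length (hargs i)⟩
    ⟨g, ⟨hargs, hmatch _ _ hhead⟩, fun e he => ?_⟩
  exact (hcomps _ (mem_toList_ofList_map.2 ⟨e, he, rfl⟩)).holds hp hfalse hwγ hw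

theorem Justified.matching_holds {q₂ q₁ γ l l' : Tree} (hm : Justified q₂ q₁ p (.matching γ l l'))
    (hp : ∀ m ∈ p, m.Holds v) : (Line.matching γ l l').Holds v := by
  intro w hw
  rcases hm with ⟨rfl, rfl⟩ | ⟨hl, hl', htl, r, hr, hhd, heq⟩
  · rfl
  · match l, l' with
    | .cons a l, .cons b l' =>
      have hhead : w a = v b := by
        rw [← show r.hd = a from hhd, hw r hr]
        exact heq.value_eq fun g hg => hp _ hg
      exact congrArg₂ List.cons hhead (hp _ htl w hw)

theorem Justified.add_holds {q₂ q₁ c x y z : Tree} (hm : Justified q₂ q₁ p (.add c x y z))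
    (hp : ∀ m ∈ p, m.Holds v) : (Line.add c x y z).Holds v := by
  rcases hm with ⟨rfl, rfl, rfl, rfl⟩ | ⟨c', htl, hdigit⟩
  · rfl
  · have htl : c'.digit + x.tl.num + y.tl.num = z.tl.num := hp _ htl
    change c.digit + x.num + y.num = z.num
    rw [x.num_eq, y.num_eq, z.num_eq]
    omega

theorem Justified.mul_holds {q₂ q₁ x y z : Tree} (hm : Justified q₂ q₁ p (.mul x y z))
    (hp : ∀ m ∈ p, m.Holds v) : (Line.mul x y z).Holds v := by
  rcases hm with ⟨rfl, rfl⟩ | ⟨m, htl, ⟨hx, hadd⟩ | ⟨hx, hadd⟩⟩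
  · exact Nat.zero_mul _
  all_goals
    have htl : x.tl.num * y.num = m.num := hp _ htl
    have hadd := hp _ hadd
    change x.num * y.num = z.num
    simp only [Line.Holds, Tree.num, Tree.digit] at hadd
    rw [x.num_eq, ← hadd, ← htl]
  · simp only [hx, Tree.digit]
    ring
  · obtain ⟨a, b, hab⟩ : ∃ a b, x.hd = .cons a b := by cases hx' : x.hd <;> simp_all
    simp only [hab, Tree.digit]
    ring

theorem Justified.holds {m : Line} (hm : Justified Q₂.encode Q₁.encode p m)
    (hp : ∀ m ∈ p, m.Holds (codeValue ι h)) (hQ₂ : Q₂.CompsHold ι h)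
    (hQ : ∀ μ : ContainmentMapping Q₁ Q₂, ¬ μ.CompsHold ι h) : m.Holds (codeValue ι h) := by
  cases m with
  | fact f =>
    rcases hm with hf | hf | hf | hf
    · exact hf.holds fun g hg => hp _ hg
    · exact hf.holds hQ₂
    · exact hf.holds hp
    · exact hf.holds hp hQ
  | matching γ l l' => exact hm.matching_holds hp
  | add c x y z => exact hm.add_holds hp
  | mul x y z => exact hm.mul_holds hp

theorem IsRefutation.contained {y : Tree} (hy : IsRefutation Q₂.encode Q₁.encode y) :
    Contained ι Q₂ Q₁ := by
  refine contained_iff.2 fun h hh => ?_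
  by_contra! hQ
  obtain ⟨hvalid, t, ht⟩ := hy
  have hholds : ∀ m ∈ coded y, m.Holds (codeValue ι h) := by
    clear ht
    induction y with
    | nil => simp [coded, Tree.toList]
    | cons a b _ ih =>
      obtain ⟨m, rfl, hm⟩ := hvalid _ List.mem_cons_self
      have hb := ih fun s hs => hvalid s (List.mem_cons_of_mem _ hs)
      intro m' hm'
      rcases List.mem_cons.1 hm' with hm' | hm'
      · rw [Line.encode_injective hm']
        exact hm.holds hb hh hQ
      · exact hb m' hm'
  exact lt_irrefl _ (hholds _ ht)

end Soundness

/-! ### Derivations are checked in polynomial time -/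

/-- The functions from trees to facts whose two sides are elementary functions. -/
inductive ElementaryFact : (Tree → Fact Tree) → Prop
  | le {t u : Tree → Tree} :
      Elementary t → Elementary u → ElementaryFact fun v => .le (t v) (u v)
  | lt {t u : Tree → Tree} :
      Elementary t → Elementary u → ElementaryFact fun v => .lt (t v) (u v)
  | ne {t u : Tree → Tree} :
      Elementary t → Elementary u → ElementaryFact fun v => .ne (t v) (u v)

/-- The functions from trees to lines of a fixed kind whose components are elementary functions. -/
inductive ElementaryLine : (Tree → Line) → Prop
  | fact {F : Tree → Fact Tree} : ElementaryFact F → ElementaryLine fun v => .fact (F v)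
  | matching {γ l l' : Tree → Tree} : Elementary γ → Elementary l → Elementary l' →
      ElementaryLine fun v => .matching (γ v) (l v) (l' v)
  | add {c x y z : Tree → Tree} : Elementary c → Elementary x → Elementary y → Elementary z →
      ElementaryLine fun v => .add (c v) (x v) (y v) (z v)
  | mul {x y z : Tree → Tree} : Elementary x → Elementary y → Elementary z →
      ElementaryLine fun v => .mul (x v) (y v) (z v)

theorem ElementaryFact.comp {F : Tree → Fact Tree} {f : Tree → Tree} (hF : ElementaryFact F)
    (hf : Elementary f) : ElementaryFact fun v => F (f v) := by
  cases hF with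
  | le ht hu => exact .le (ht.comp hf) (hu.comp hf)
  | lt ht hu => exact .lt (ht.comp hf) (hu.comp hf)
  | ne ht hu => exact .ne (ht.comp hf) (hu.comp hf)

theorem ElementaryLine.encode {F : Tree → Line} (hF : ElementaryLine F) :
    Elementary fun v => (F v).encode := by
  rcases hF with (⟨ht, hu⟩ | ⟨ht, hu⟩ | ⟨ht, hu⟩) | ⟨hγ, hl, hl'⟩ | ⟨hc, hx, hy, hz⟩ | ⟨hx, hy, hz⟩
  · exact (Elementary.const _).cons (ht.cons hu)
  · exact (Elementary.const _).cons (ht.cons hu)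
  · exact (Elementary.const _).cons (ht.cons hu)
  · exact (Elementary.const _).cons (hγ.cons (hl.cons hl'))
  · exact (Elementary.const _).cons (hc.cons (hx.cons (hy.cons hz)))
  · exact (Elementary.const _).cons (hx.cons (hy.cons hz))

section

variable {f g t u q q' a b c d : Tree → Tree} {F G : Tree → Fact Tree} {L : Tree → Line}

theorem checkable_fact_eq (hF : ElementaryFact F) (hG : ElementaryFact G) :
    Checkable fun v => F v = G v :=
  (Checkable.eq (ElementaryLine.fact hF).encode (ElementaryLine.fact hG).encode).of_iff fun v => by
    rw [Line.encode_injective.eq_iff, Line.fact.injEq]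

theorem checkable_mem_coded (hL : ElementaryLine L) (hg : Elementary g) :
    Checkable fun v => L v ∈ coded (g v) :=
  Checkable.mem hL.encode hg

theorem checkable_exists_mem_coded {L : Tree → Tree → Line} {r : Tree → Tree}
    {B : Tree → Tree → Prop} (hrL : ∀ m v, r (L m v).encode = m) (hg : Elementary g)
    (hr : Elementary r) (hL : ElementaryLine fun v => L v.hd v.tl)
    (hB : Checkable fun v => B v.hd v.tl) : Checkable fun v => ∃ m, L m v ∈ coded (g v) ∧ B m v :=
  Checkable.exists_mem_of_leftInverse hrL hg hr hL.encode hB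

theorem checkable_exists_eq_encode {B : Line → Tree → Prop} (hf : Elementary f)
    (hB : ∀ L, ElementaryLine L → Checkable fun v => B (L v) v) :
    Checkable fun v => ∃ m : Line, f v = m.encode ∧ B m v := by
  have decode {L : Tree → Line} (hL : ElementaryLine fun v => L (f v)) :
      Checkable fun v => f v = (L (f v)).encode ∧ B (L (f v)) v :=
    (Checkable.eq hf hL.encode).and (hB _ hL)
  refine ((decode (L := fun t => .fact (.le t.tl.hd t.tl.tl)) (.fact (.le hf.tl.hd hf.tl.tl))).or
    ((decode (L := fun t => .fact (.lt t.tl.hd t.tl.tl)) (.fact (.lt hf.tl.hd hf.tl.tl))).or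
    ((decode (L := fun t => .fact (.ne t.tl.hd t.tl.tl)) (.fact (.ne hf.tl.hd hf.tl.tl))).or
    ((decode (L := fun t => .matching t.tl.hd t.tl.tl.hd t.tl.tl.tl)
      (.matching hf.tl.hd hf.tl.tl.hd hf.tl.tl.tl)).or
    ((decode (L := fun t => .add t.tl.hd t.tl.tl.hd t.tl.tl.tl.hd t.tl.tl.tl.tl)
      (.add hf.tl.hd hf.tl.tl.hd hf.tl.tl.tl.hd hf.tl.tl.tl.tl)).or
    (decode (L := fun t => .mul t.tl.hd t.tl.tl.hd t.tl.tl.tl)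
      (.mul hf.tl.hd hf.tl.tl.hd hf.tl.tl.tl))))))).of_iff fun v => ⟨?_, ?_⟩
  · rintro (h | h | h | h | h | h) <;> exact ⟨_, h⟩
  · rintro ⟨⟨⟨⟩ | ⟨⟩ | ⟨⟩⟩ | _ | _ | _, h, hm⟩ <;>
      simp [h, hm, Line.encode, Tree.ofNat_injective.eq_iff]

theorem checkable_exists_compOp {P : CompOp → Tree → Prop} (hP : ∀ op, Checkable (P op)) :
    Checkable fun v => ∃ op, P op v :=
  ((hP .lt).or ((hP .gt).or ((hP .le).or ((hP .ge).or ((hP .eq).or (hP .ne)))))).of_iff fun _ =>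
    ⟨by rintro (h | h | h | h | h | h) <;> exact ⟨_, h⟩,
      by rintro ⟨⟨⟩, h⟩ <;> simp [h]⟩

theorem checkable_mem_asserts (op : CompOp) (hF : ElementaryFact F) (ht : Elementary t)
    (hu : Elementary u) : Checkable fun v => F v ∈ op.asserts (t v) (u v) := by
  cases op <;> simp only [CompOp.asserts, List.mem_cons, List.not_mem_nil, or_false]
  · exact checkable_fact_eq hF (.lt ht hu)
  · exact checkable_fact_eq hF (.lt hu ht)
  · exact checkable_fact_eq hF (.le ht hu)
  · exact checkable_fact_eq hF (.le hu ht)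
  · exact (checkable_fact_eq hF (.le ht hu)).or (checkable_fact_eq hF (.le hu ht))
  · exact checkable_fact_eq hF (.ne ht hu)

theorem checkable_mem_refutes (op : CompOp) (hF : ElementaryFact F) (ht : Elementary t)
    (hu : Elementary u) : Checkable fun v => F v ∈ op.refutes (t v) (u v) := by
  cases op <;> simp only [CompOp.refutes, List.mem_cons, List.not_mem_nil, or_false]
  · exact checkable_fact_eq hF (.le hu ht)
  · exact checkable_fact_eq hF (.le ht hu)
  · exact checkable_fact_eq hF (.lt hu ht)
  · exact checkable_fact_eq hF (.lt ht hu)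
  · exact .const False
  · exact (checkable_fact_eq hF (.le ht hu)).or (checkable_fact_eq hF (.le hu ht))

theorem checkable_provEq (hg : Elementary g) (ht : Elementary t) (hu : Elementary u) :
    Checkable fun v => ProvEq (Line.fact ⁻¹' coded (g v)) (t v) (u v) :=
  (checkable_mem_coded (.fact (.le ht hu)) hg).and (checkable_mem_coded (.fact (.le hu ht)) hg)

theorem checkable_orderStep (hg : Elementary g) (hF : ElementaryFact F) :
    Checkable fun v => OrderStep (Line.fact ⁻¹' coded (g v)) (F v) := by
  have mem {G : Tree → Fact Tree} (hG : ElementaryFact G) :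
      Checkable fun v => Line.fact (G v) ∈ coded (g v) := checkable_mem_coded (.fact hG) hg
  have last {t : Tree → Tree} (ht : Elementary t) :
      Checkable fun v => Line.fact (.le v.hd (t v.tl)) ∈ coded (g v.tl) :=
    checkable_mem_coded (.fact (.le Elementary.id.hd (ht.comp Elementary.id.tl)))
      (hg.comp Elementary.id.tl)
  cases hF with
  | @le t u ht hu =>
    exact (Checkable.eq ht hu).or ((mem (.lt ht hu)).or
      (checkable_exists_mem_coded (L := fun m v => .fact (.le (t v) m)) (fun _ _ => rfl) hg
        Elementary.id.tl.tl (.fact (.le (ht.comp Elementary.id.tl) Elementary.id.hd)) (last hu)))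
  | @lt t u ht hu =>
    exact ((mem (.le ht hu)).and (mem (.ne ht hu))).or
      (checkable_exists_mem_coded (L := fun m v => .fact (.lt (t v) m)) (fun _ _ => rfl) hg
        Elementary.id.tl.tl (.fact (.lt (ht.comp Elementary.id.tl) Elementary.id.hd)) (last hu))
  | ne => exact .const False

theorem checkable_comparisonStep (hq : Elementary q) (hF : ElementaryFact F) :
    Checkable fun v => ComparisonStep (q v) (F v) :=
  Checkable.exists_mem (B := fun e v => ∃ op : CompOp, e.hd = op.encode ∧
      F v ∈ op.asserts (Tree.cons (Tree.ofBool false) e.tl.hd) e.tl.tl) hq.tl.tl <|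
    checkable_exists_compOp fun op => (Checkable.eq Elementary.id.hd.hd (.const _)).and
      (checkable_mem_asserts op (hF.comp Elementary.id.tl)
        ((Elementary.const _).cons Elementary.id.hd.tl.hd) Elementary.id.hd.tl.tl)

theorem checkable_mulLt (hg : Elementary g) (ha : Elementary a) (hb : Elementary b)
    (hc : Elementary c) (hd : Elementary d) :
    Checkable fun v => MulLt (coded (g v)) (a v) (b v) (c v) (d v) := by
  have tail {f : Tree → Tree} (hf : Elementary f) : Elementary fun v => f v.tl :=
    hf.comp Elementary.id.tl
  refine checkable_exists_mem_coded (L := fun m v => .mul (a v) (b v) m)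
    (B := fun m v => ∃ n, .mul (c v) (d v) n ∈ coded (g v) ∧
      ∃ k, .add (Tree.ofBool true) m k n ∈ coded (g v)) (fun _ _ => rfl) hg
    Elementary.id.tl.tl.tl (.mul (tail ha) (tail hb) Elementary.id.hd) ?_
  refine checkable_exists_mem_coded (L := fun n v => .mul (c v.tl) (d v.tl) n)
    (B := fun n v => ∃ k, .add (Tree.ofBool true) v.hd k n ∈ coded (g v.tl)) (fun _ _ => rfl)
    (tail hg) Elementary.id.tl.tl.tl (.mul (tail (tail hc)) (tail (tail hd)) Elementary.id.hd) ?_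
  exact (checkable_exists_mem_coded (L := fun k v => .add (Tree.ofBool true) v.tl.hd k v.hd)
    (B := fun _ _ => True) (fun _ _ => rfl) (tail (tail hg)) Elementary.id.tl.tl.tl.hd
    (.add (.const _) Elementary.id.tl.tl.hd Elementary.id.hd Elementary.id.tl.hd)
    (.const True)).of_iff fun v => by simp only [and_true]

theorem checkable_ratLt (hg : Elementary g) (ht : Elementary t) (hu : Elementary u) :
    Checkable fun v => RatLt (coded (g v)) (t v) (u v) := by
  have isNil {f : Tree → Tree} (hf : Elementary f) : Checkable fun v => f v = .nil := .eq hf .nil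
  exact (Checkable.num_ne_zero ht.tl.tl).and <| (Checkable.num_ne_zero hu.tl.tl).and <|
    ((isNil ht.hd).not.and ((isNil hu.hd).and (.num_ne_zero ht.tl.hd))).or <|
    ((isNil ht.hd).and ((isNil hu.hd).and
      (checkable_mulLt hg ht.tl.hd hu.tl.tl hu.tl.hd ht.tl.tl))).or
    ((isNil ht.hd).not.and ((isNil hu.hd).not.and
      (checkable_mulLt hg hu.tl.hd ht.tl.tl ht.tl.hd hu.tl.tl)))

theorem checkable_constStep (hg : Elementary g) (hF : ElementaryFact F) :
    Checkable fun v => ConstStep (coded (g v)) (F v) := by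
  cases hF with
  | lt ht hu =>
    exact (Checkable.eq ht.hd .nil).not.and ((Checkable.eq hu.hd .nil).not.and
      (checkable_ratLt hg ht.tl hu.tl))
  | le => exact .const False
  | ne => exact .const False

theorem checkable_isSubst (hf : Elementary f) : Checkable fun v => IsSubst (f v) := by
  have arg := Elementary.id
  exact (Checkable.forall_mem (B := fun r v => ∀ r' ∈ (f v).toList, r.hd = r'.hd → r.tl = r'.tl) hf
      (Checkable.forall_mem (B := fun r' v => v.hd.hd = r'.hd → v.hd.tl = r'.tl) (hf.comp arg.tl)
        ((Checkable.eq arg.tl.hd.hd arg.hd.hd).imp (.eq arg.tl.hd.tl arg.hd.tl)))).and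
    (Checkable.forall_mem (B := fun r _ => r.hd.hd ≠ .nil → r.tl = r.hd) hf
      ((Checkable.eq arg.hd.hd.hd .nil).not.imp (.eq arg.hd.tl arg.hd.hd)))

theorem checkable_equationOrRefuted (hg : Elementary g) (hf : Elementary f) (ht : Elementary t)
    (hF : ElementaryFact F) :
    Checkable fun v => EquationOrRefuted (Line.fact ⁻¹' coded (g v)) (f v) (t v) (F v) := by
  have arg := Elementary.id
  refine Checkable.exists_mem (B := fun l v => ∃ r ∈ (f v).toList,
    l.hd = .cons (Tree.ofBool false) (t v).tl.hd ∧ r.hd = (t v).tl.tl ∧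
    ∃ op : CompOp, (t v).hd = op.encode ∧ (op = .eq ∧
      ProvEq (Line.fact ⁻¹' coded (g v)) l.tl r.tl ∨ F v ∈ op.refutes l.tl r.tl)) hf ?_
  refine Checkable.exists_mem (B := fun r v => v.hd.hd = .cons (Tree.ofBool false) (t v.tl).tl.hd ∧
    r.hd = (t v.tl).tl.tl ∧ ∃ op : CompOp, (t v.tl).hd = op.encode ∧ (op = .eq ∧
      ProvEq (Line.fact ⁻¹' coded (g v.tl)) v.hd.tl r.tl ∨ F v.tl ∈ op.refutes v.hd.tl r.tl))
    (hf.comp arg.tl) ?_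
  have ht := ht.comp arg.tl.tl
  exact (Checkable.eq arg.tl.hd.hd ((Elementary.const _).cons ht.tl.hd)).and <|
    (Checkable.eq arg.hd.hd ht.tl.tl).and <| checkable_exists_compOp fun op =>
      (Checkable.eq ht.hd (.const _)).and <|
        ((Checkable.const _).and (checkable_provEq (hg.comp arg.tl.tl) arg.tl.hd.tl arg.hd.tl)).or
          (checkable_mem_refutes op (hF.comp arg.tl.tl) arg.tl.hd.tl arg.hd.tl)

theorem checkable_mappingStep (hq : Elementary q) (hq' : Elementary q') (hg : Elementary g)
    (hF : ElementaryFact F) :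
    Checkable fun v => MappingStep (q v) (q' v) (coded (g v)) (F v) := by
  have arg := Elementary.id
  refine checkable_exists_mem_coded (L := fun γ v => .matching γ (q' v).hd (q v).hd)
    (B := fun γ v => IsSubst γ ∧ (∀ a ∈ (q' v).tl.hd.toList, ∃ b ∈ (q v).tl.hd.toList,
      a.hd = b.hd ∧ .matching γ a.tl b.tl ∈ coded (g v)) ∧
      ∀ e ∈ (q' v).tl.tl.toList, EquationOrRefuted (Line.fact ⁻¹' coded (g v)) γ e (F v))
    (fun _ _ => rfl) hg arg.tl.hd
    (.matching arg.hd (hq'.comp arg.tl).hd (hq.comp arg.tl).hd) ?_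
  refine (checkable_isSubst arg.hd).and (.and ?_ ?_)
  · refine Checkable.forall_mem (B := fun a v => ∃ b ∈ (q v.tl).tl.hd.toList,
      a.hd = b.hd ∧ .matching v.hd a.tl b.tl ∈ coded (g v.tl)) (hq'.comp arg.tl).tl.hd ?_
    refine Checkable.exists_mem (B := fun b v => v.hd.hd = b.hd ∧
      .matching v.tl.hd v.hd.tl b.tl ∈ coded (g v.tl.tl)) (hq.comp arg.tl.tl).tl.hd ?_
    exact (Checkable.eq arg.tl.hd.hd arg.hd.hd).and
      (checkable_mem_coded (.matching arg.tl.tl.hd arg.tl.hd.tl arg.hd.tl) (hg.comp arg.tl.tl.tl))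
  · exact Checkable.forall_mem (B := fun e v => EquationOrRefuted
      (Line.fact ⁻¹' coded (g v.tl)) v.hd e (F v.tl)) (hq'.comp arg.tl).tl.tl
      (checkable_equationOrRefuted (hg.comp arg.tl.tl) arg.tl.hd arg.hd (hF.comp arg.tl.tl))

theorem checkable_digit_sum_eq (ha : Elementary a) (hb : Elementary b) (hc : Elementary c)
    (hd : Elementary d) (hf : Elementary f) : Checkable fun v =>
      (a v).digit + (b v).digit + (c v).digit = (d v).digit + 2 * (f v).digit :=
  .digit (P := fun i v => i + (b v).digit + (c v).digit = (d v).digit + 2 * (f v).digit) ha fun i =>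
  .digit (P := fun j v => i + j + (c v).digit = (d v).digit + 2 * (f v).digit) hb fun j =>
  .digit (P := fun k v => i + j + k = (d v).digit + 2 * (f v).digit) hc fun k =>
  .digit (P := fun l v => i + j + k = l + 2 * (f v).digit) hd fun l =>
  .digit (P := fun m _ => i + j + k = l + 2 * m) hf fun m => .const (i + j + k = l + 2 * m)

theorem checkable_justified (hq : Elementary q) (hq' : Elementary q') (hg : Elementary g)
    (hL : ElementaryLine L) : Checkable fun v => Justified (q v) (q' v) (coded (g v)) (L v) := by
  have arg := Elementary.id
  have isNil {f : Tree → Tree} (hf : Elementary f) : Checkable fun v => f v = .nil := .eq hf .nil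
  cases hL with
  | fact hF =>
    exact (checkable_orderStep hg hF).or ((checkable_comparisonStep hq hF).or
      ((checkable_constStep hg hF).or (checkable_mappingStep hq hq' hg hF)))
  | @matching γ l l' hγ hl hl' =>
    exact ((isNil hl).and (isNil hl')).or <| (isNil hl).not.and <| (isNil hl').not.and <|
      (checkable_mem_coded (.matching hγ hl.tl hl'.tl) hg).and <|
      Checkable.exists_mem (B := fun r v => r.hd = (l v).hd ∧
        ProvEq (Line.fact ⁻¹' coded (g v)) r.tl (l' v).hd) hγ <|
      (Checkable.eq arg.hd.hd (hl.hd.comp arg.tl)).and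
        (checkable_provEq (hg.comp arg.tl) arg.hd.tl (hl'.hd.comp arg.tl))
  | @add c x y z hc hx hy hz =>
    exact ((isNil hc).and ((isNil hx).and ((isNil hy).and (isNil hz)))).or <|
      checkable_exists_mem_coded (L := fun c' v => .add c' (x v).tl (y v).tl (z v).tl)
        (B := fun c' v => (c v).digit + (x v).hd.digit + (y v).hd.digit =
          (z v).hd.digit + 2 * c'.digit) (fun _ _ => rfl) hg arg.tl.hd
        (.add arg.hd (hx.comp arg.tl).tl (hy.comp arg.tl).tl (hz.comp arg.tl).tl)
        (checkable_digit_sum_eq (hc.comp arg.tl) (hx.comp arg.tl).hd (hy.comp arg.tl).hd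
          (hz.comp arg.tl).hd arg.hd)
  | @mul x y z hx hy hz =>
    refine ((isNil hx).and (isNil hz)).or <|
      checkable_exists_mem_coded (L := fun m v => .mul (x v).tl (y v) m)
        (B := fun m v => (x v).hd = .nil ∧ .add .nil (.cons .nil m) .nil (z v) ∈ coded (g v) ∨
          (x v).hd ≠ .nil ∧ .add .nil (.cons .nil m) (y v) (z v) ∈ coded (g v))
        (fun _ _ => rfl) hg arg.tl.tl.tl (.mul (hx.comp arg.tl).tl (hy.comp arg.tl) arg.hd) ?_
    have hm : Elementary fun v => .cons .nil v.hd := Elementary.nil.cons arg.hd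
    exact ((isNil (hx.comp arg.tl).hd).and
        (checkable_mem_coded (.add .nil hm .nil (hz.comp arg.tl)) (hg.comp arg.tl))).or
      ((isNil (hx.comp arg.tl).hd).not.and
        (checkable_mem_coded (.add .nil hm (hy.comp arg.tl) (hz.comp arg.tl)) (hg.comp arg.tl)))

theorem checkable_isRefutation (hq : Elementary q) (hq' : Elementary q') (hf : Elementary f) :
    Checkable fun v => IsRefutation (q v) (q' v) (f v) := by
  have arg := Elementary.id
  refine (Checkable.forall_suffix (B := fun s v => ∃ m : Line, s.hd = m.encode ∧
    Justified (q v) (q' v) (coded s.tl) m) hf ?_).and ?_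
  · exact checkable_exists_eq_encode (B := fun m v => Justified (q v.tl) (q' v.tl)
      (coded v.hd.tl) m) arg.hd.hd fun L hL =>
        checkable_justified (hq.comp arg.tl) (hq'.comp arg.tl) arg.hd.tl hL
  · exact (checkable_exists_mem_coded (L := fun t _ => .fact (.lt t t)) (B := fun _ _ => True)
      (fun _ _ => rfl) hf arg.tl.tl (.fact (.lt arg.hd arg.hd)) (.const True)).of_iff fun v => by
        simp only [and_true]

end

/-! ### Short derivations -/

theorem Line.size_encode_fact_le {f : Fact Tree} {s : ℕ} (hf : f.Over {t | t.size ≤ s}) :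
    (fact f).encode.size ≤ 2 * s + 15 := by
  have htag : ∀ k < 2 ^ 3, (Tree.ofNat k).size ≤ 13 := fun k => Tree.size_ofNat_le
  rcases f with ⟨t, u⟩ | ⟨t, u⟩ | ⟨t, u⟩ <;> obtain ⟨ht, hu⟩ := hf <;>
    change _ ≤ s at ht hu <;> simp only [encode, Tree.size]
  · linarith [htag 0 (by norm_num)]
  · linarith [htag 1 (by norm_num)]
  · linarith [htag 2 (by norm_num)]

theorem Line.size_encode_matching_le (γ l l' : Tree) :
    (matching γ l l').encode.size ≤ γ.size + l.size + l'.size + 16 := by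
  have htag : (Tree.ofNat 3).size ≤ 4 * 3 + 1 := Tree.size_ofNat_le (by norm_num)
  simp only [encode, Tree.size]
  omega

theorem Line.size_encode_add_le (c x y z : Tree) :
    (add c x y z).encode.size ≤ c.size + x.size + y.size + z.size + 17 := by
  have htag : (Tree.ofNat 4).size ≤ 4 * 3 + 1 := Tree.size_ofNat_le (by norm_num)
  simp only [encode, Tree.size]
  omega

theorem Line.size_encode_mul_le (x y z : Tree) :
    (mul x y z).encode.size ≤ x.size + y.size + z.size + 16 := by
  have htag : (Tree.ofNat 5).size ≤ 4 * 3 + 1 := Tree.size_ofNat_le (by norm_num)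
  simp only [encode, Tree.size]
  omega

/-- The set of lines arises from `p` by `n` derivation steps, whose lines have codes of size at
most `M`. -/
inductive Extends (q₂ q₁ : Tree) (M : ℕ) (p : Set Line) : ℕ → Set Line → Prop
  | refl : Extends q₂ q₁ M p 0 p
  | step {n : ℕ} {q : Set Line} {m : Line} : Extends q₂ q₁ M p n q → Justified q₂ q₁ q m →
      m.encode.size ≤ M → Extends q₂ q₁ M p (n + 1) (insert m q)

/-- At most `n` derivation steps lead from the lines `p` to lines with the property `R`. -/
def Reaches (q₂ q₁ : Tree) (M : ℕ) (p : Set Line) (n : ℕ) (R : Set Line → Prop) : Prop :=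
  ∃ k ≤ n, ∃ q, Extends q₂ q₁ M p k q ∧ R q

section

variable {q₂ q₁ : Tree} {M n n' : ℕ} {p q : Set Line} {R R' : Set Line → Prop}

theorem Extends.subset (h : Extends q₂ q₁ M p n q) : p ⊆ q := by
  induction h with
  | refl => exact subset_rfl
  | step _ _ _ ih => exact ih.trans (Set.subset_insert _ _)

theorem Extends.trans {r : Set Line} (h : Extends q₂ q₁ M p n q) (h' : Extends q₂ q₁ M q n' r) :
    Extends q₂ q₁ M p (n + n') r := by
  induction h' with
  | refl => exact h
  | step _ hm hM ih => exact ih.step hm hM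

theorem coded_cons (m : Line) (y : Tree) : coded (m.encode.cons y) = insert m (coded y) := by
  ext m'
  simp [coded, Tree.toList, Line.encode_injective.eq_iff]

theorem Extends.exists_coded_eq (h : Extends q₂ q₁ M ∅ n q) :
    ∃ y : Tree, y.size ≤ n * (M + 1) + 1 ∧ coded y = q ∧
      ∀ s ∈ y.suffixes, ∃ m : Line, s.hd = m.encode ∧ Justified q₂ q₁ (coded s.tl) m := by
  induction h with
  | refl => exact ⟨.nil, by simp [Tree.size], by simp [coded, Tree.toList], by simp [Tree.suffixes]⟩
  | @step n q m _ hm hM ih =>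
    obtain ⟨y, hsize, rfl, hy⟩ := ih
    refine ⟨.cons m.encode y, by simp only [Tree.size]; linarith, coded_cons m y, fun s hs => ?_⟩
    rcases List.mem_cons.1 hs with rfl | hs
    · exact ⟨m, rfl, hm⟩
    · exact hy s hs

theorem Reaches.exists_isRefutation
    (h : Reaches q₂ q₁ M ∅ n fun q => ∃ t, .fact (.lt t t) ∈ q) :
    ∃ y : Tree, y.size ≤ n * (M + 1) + 1 ∧ IsRefutation q₂ q₁ y := by
  obtain ⟨k, hk, q, hq, ht⟩ := h
  obtain ⟨y, hsize, rfl, hy⟩ := hq.exists_coded_eq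
  exact ⟨y, hsize.trans (by gcongr), hy, ht⟩

theorem Reaches.of_holds (hp : R p) : Reaches q₂ q₁ M p 0 R := ⟨0, le_rfl, p, .refl, hp⟩

theorem Reaches.of_justified {m : Line} (hm : Justified q₂ q₁ p m) (hM : m.encode.size ≤ M) :
    Reaches q₂ q₁ M p 1 (m ∈ ·) :=
  ⟨1, le_rfl, _, .step .refl hm hM, Set.mem_insert m p⟩

theorem Reaches.mono (h : Reaches q₂ q₁ M p n R) (hn : n ≤ n') : Reaches q₂ q₁ M p n' R :=
  let ⟨k, hk, hq⟩ := h
  ⟨k, hk.trans hn, hq⟩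

theorem Reaches.bind (h : Reaches q₂ q₁ M p n R)
    (h' : ∀ q, p ⊆ q → R q → Reaches q₂ q₁ M q n' R') : Reaches q₂ q₁ M p (n + n') R' := by
  obtain ⟨k, hk, q, hq, hR⟩ := h
  obtain ⟨k', hk', r, hr, hR'⟩ := h' q hq.subset hR
  exact ⟨k + k', Nat.add_le_add hk hk', r, hq.trans hr, hR'⟩

theorem Reaches.forall_mem {α : Type*} {L : α → Line} {l : List α}
    (h : ∀ a ∈ l, ∀ q, p ⊆ q → Reaches q₂ q₁ M q n (L a ∈ ·)) :
    Reaches q₂ q₁ M p (l.length * n) fun q => p ⊆ q ∧ ∀ a ∈ l, L a ∈ q := by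
  induction l with
  | nil => exact (Reaches.of_holds ⟨subset_rfl, by simp⟩).mono (Nat.zero_le _)
  | cons a l ih =>
    rw [List.length_cons, Nat.succ_mul]
    refine (ih fun b hb => h b (List.mem_cons_of_mem a hb)).bind fun q hpq hl => ?_
    obtain ⟨k, hk, r, hr, ha⟩ := h a List.mem_cons_self q hpq
    refine ⟨k, hk, r, hr, hpq.trans hr.subset, fun b hb => ?_⟩
    rcases List.mem_cons.1 hb with rfl | hb
    · exact ha
    · exact hr.subset (hl.2 b hb)

theorem exists_carry {c x y z : Tree} {k l m : ℕ}
    (h : c.digit + (x.digit + 2 * k) + (y.digit + 2 * l) = z.digit + 2 * m) :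
    ∃ c' : Tree, c'.size ≤ 3 ∧ c.digit + x.digit + y.digit = z.digit + 2 * c'.digit ∧
      c'.digit + k + l = m := by
  have hc := c.digit_le_one
  have hx := x.digit_le_one
  have hy := y.digit_le_one
  have hz := z.digit_le_one
  by_cases hcarry : 2 ≤ c.digit + x.digit + y.digit
  · refine ⟨.ofBool true, le_rfl, ?_⟩
    rw [show (Tree.ofBool true).digit = 1 from rfl]
    omega
  · refine ⟨.ofBool false, by simp [Tree.ofBool, Tree.size], ?_⟩
    rw [show (Tree.ofBool false).digit = 0 from rfl]
    omega

theorem reaches_add {c x y z : Tree} (hc : c.size ≤ 3) (hM : x.size + y.size + z.size + 20 ≤ M)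
    (h : c.digit + x.num + y.num = z.num) (p : Set Line) :
    Reaches q₂ q₁ M p (x.size + y.size + z.size) (.add c x y z ∈ ·) := by
  induction hn : x.size + y.size + z.size using Nat.strong_induction_on
    generalizing c x y z with
  | _ n ih =>
    subst hn
    have hsize : (Line.add c x y z).encode.size ≤ M := by
      have := Line.size_encode_add_le c x y z
      omega
    by_cases hnil : x = .nil ∧ y = .nil ∧ z = .nil
    · obtain ⟨rfl, rfl, rfl⟩ := hnil
      have hstep : Justified q₂ q₁ p (.add c .nil .nil .nil) :=
        Or.inl ⟨Tree.digit_eq_zero.1 h, rfl, rfl, rfl⟩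
      exact (Reaches.of_justified hstep hsize).mono (by simp only [Tree.size]; omega)
    · have htl : x.tl.size + y.tl.size + z.tl.size < x.size + y.size + z.size := by
        cases x <;> cases y <;> cases z <;> simp [Tree.size, Tree.tl] at hnil ⊢ <;> omega
      rw [x.num_eq, y.num_eq, z.num_eq] at h
      obtain ⟨c', hc', hdigit, hrest⟩ := exists_carry h
      have hstep : ∀ q, .add c' x.tl y.tl z.tl ∈ q → Justified q₂ q₁ q (.add c x y z) :=
        fun _ hq => Or.inr ⟨c', hq, hdigit⟩
      exact ((ih _ htl hc' (by omega) hrest rfl).bind fun q _ hq =>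
        .of_justified (hstep q hq) hsize).mono htl

theorem num_mul_num_lt_two_pow {x y : Tree} {s : ℕ} (hx : x.size ≤ s) (hy : y.size ≤ s) :
    x.num * y.num < 2 ^ (2 * s) := by
  rw [two_mul, pow_add]
  exact Nat.mul_lt_mul'' (x.num_lt_two_pow.trans_le (Nat.pow_le_pow_right two_pos hx))
    (y.num_lt_two_pow.trans_le (Nat.pow_le_pow_right two_pos hy))

theorem exists_justified_mul (q₂ q₁ a b y : Tree) : ∃ u : Tree, u.size ≤ y.size ∧
    (Tree.cons a b).num * y.num = 2 * (b.num * y.num) + u.num ∧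
    ∀ q m z, .mul b y m ∈ q → .add .nil (.cons .nil m) u z ∈ q →
      Justified q₂ q₁ q (.mul (.cons a b) y z) := by
  by_cases ha : a = .nil
  · refine ⟨.nil, y.size_pos, ?_, fun q m z hm hz => Or.inr ⟨m, hm, Or.inl ⟨ha, hz⟩⟩⟩
    simp only [ha, Tree.num]
    ring
  · refine ⟨y, le_rfl, ?_, fun q m z hm hz => Or.inr ⟨m, hm, Or.inr ⟨ha, hz⟩⟩⟩
    obtain ⟨c, d, rfl⟩ : ∃ c d, a = .cons c d := by cases a <;> simp_all
    simp only [Tree.num]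
    ring

theorem reaches_mul {x y : Tree} {s : ℕ} (hx : x.size ≤ s) (hy : y.size ≤ s)
    (hM : 17 * s + 24 ≤ M) (p : Set Line) :
    Reaches q₂ q₁ M p (x.size * M) (.mul x y (Tree.ofNat (x.num * y.num)) ∈ ·) := by
  induction x with
  | nil =>
    have hzero : Tree.ofNat ((.nil : Tree).num * y.num) = .nil := by
      simp [Tree.num, Tree.ofNat, Tree.ofList]
    rw [hzero]
    have hstep : Justified q₂ q₁ p (.mul .nil y .nil) := Or.inl ⟨rfl, rfl⟩
    have hsize := Line.size_encode_mul_le .nil y .nil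
    simp only [Tree.size] at hsize ⊢
    exact (Reaches.of_justified hstep (by omega)).mono (by omega)
  | cons a b _ ih =>
    obtain ⟨u, hu, hsum, hjust⟩ := exists_justified_mul q₂ q₁ a b y
    have hb : b.size ≤ s := by simp only [Tree.size] at hx; omega
    have hmsize := Tree.size_ofNat_le (num_mul_num_lt_two_pow hb hy)
    have hzsize := Tree.size_ofNat_le (num_mul_num_lt_two_pow hx hy)
    have hsize := Line.size_encode_mul_le (.cons a b) y (.ofNat ((Tree.cons a b).num * y.num))
    have hadd : (.nil : Tree).digit + (Tree.cons .nil (.ofNat (b.num * y.num))).num + u.num =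
        (Tree.ofNat ((Tree.cons a b).num * y.num)).num := by
      rw [Tree.num_ofNat, hsum]
      simp only [Tree.digit, Tree.num, Tree.num_ofNat, Nat.zero_add]
    have hcount : (Tree.cons .nil (.ofNat (b.num * y.num))).size + u.size +
        (Tree.ofNat ((Tree.cons a b).num * y.num)).size + 20 ≤ M := by
      simp only [Tree.size]
      omega
    refine ((ih hb).bind fun q _ hm => (reaches_add (by simp [Tree.size]) hcount hadd q).bind
      fun r hqr hz => .of_justified (hjust r _ _ (hqr hm) hz) (by omega)).mono ?_
    calc _ ≤ b.size * M + M := by omega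
      _ ≤ (Tree.cons a b).size * M := by
        rw [← Nat.succ_mul]
        exact Nat.mul_le_mul_right M (by simp only [Tree.size]; omega)

theorem reaches_mulLt {a b c d : Tree} {s : ℕ} (ha : a.size ≤ s) (hb : b.size ≤ s)
    (hc : c.size ≤ s) (hd : d.size ≤ s) (hM : 24 * s + 24 ≤ M)
    (h : a.num * b.num < c.num * d.num) (p : Set Line) :
    Reaches q₂ q₁ M p ((2 * s + 1) * M) (MulLt · a b c d) := by
  let m := a.num * b.num
  let n := c.num * d.num
  have hn : n < 2 ^ (2 * s) := num_mul_num_lt_two_pow hc hd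
  have hmsize : (Tree.ofNat m).size ≤ _ := Tree.size_ofNat_le (h.trans hn)
  have hksize : (Tree.ofNat (n - m - 1)).size ≤ _ :=
    Tree.size_ofNat_le (lt_of_le_of_lt (by omega) hn)
  have hnsize := Tree.size_ofNat_le hn
  have hadd : (Tree.ofBool true).digit + (Tree.ofNat m).num + (Tree.ofNat (n - m - 1)).num =
      (Tree.ofNat n).num := by
    simp only [Tree.num_ofNat, Tree.ofBool, Tree.digit]
    omega
  refine Reaches.mono ((reaches_mul ha hb (by omega) p).bind fun q _ hm =>
    (reaches_mul hc hd (by omega) q).bind fun r hqr hn =>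
      (reaches_add le_rfl (by omega) hadd r).bind fun t hrt hk =>
        .of_holds ⟨_, hrt (hqr hm), _, hrt hn, _, hk⟩) ?_
  have := Nat.mul_le_mul_right M ha
  have := Nat.mul_le_mul_right M hc
  linarith

theorem reaches_ratLt {c d : ℚ} {s : ℕ} (hc : (Tree.ofRat c).size ≤ s)
    (hd : (Tree.ofRat d).size ≤ s) (hM : 24 * s + 24 ≤ M) (h : c < d) (p : Set Line) :
    Reaches q₂ q₁ M p ((2 * s + 1) * M) (RatLt · (.ofRat c) (.ofRat d)) := by
  have hcden : (Tree.ofNat c.den).num ≠ 0 := by simpa only [Tree.num_ofNat] using c.den_nz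
  have hdden : (Tree.ofNat d.den).num ≠ 0 := by simpa only [Tree.num_ofNat] using d.den_nz
  rw [Rat.lt_iff] at h
  simp only [Tree.ofRat, Tree.size] at hc hd
  rcases lt_or_ge c.num 0 with hcneg | hcnonneg <;> rcases lt_or_ge d.num 0 with hdneg | hdnonneg
  · have hlt : (Tree.ofNat d.num.natAbs).num * (Tree.ofNat c.den).num <
        (Tree.ofNat c.num.natAbs).num * (Tree.ofNat d.den).num := by
      simp only [Tree.num_ofNat]
      zify
      rw [abs_of_neg hcneg, abs_of_neg hdneg]
      linarith
    exact (reaches_mulLt (by omega) (by omega) (by omega) (by omega) hM hlt p).bind fun q _ hq =>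
      .of_holds ⟨hcden, hdden, Or.inr (Or.inr
        ⟨by simp [Tree.ofRat, hcneg, Tree.ofBool], by simp [Tree.ofRat, hdneg, Tree.ofBool], hq⟩)⟩
  · have hnum : (Tree.ofNat c.num.natAbs).num ≠ 0 := by
      simpa only [Tree.num_ofNat] using Int.natAbs_ne_zero.2 hcneg.ne
    exact (Reaches.of_holds ⟨hcden, hdden, Or.inl
      ⟨by simp [Tree.ofRat, hcneg, Tree.ofBool],
        by simp [Tree.ofRat, hdnonneg.not_gt, Tree.ofBool], hnum⟩⟩).mono (Nat.zero_le _)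
  · nlinarith [mul_nonneg hcnonneg (Int.natCast_nonneg d.den),
      mul_neg_of_neg_of_pos hdneg (Int.natCast_pos.2 c.den_pos)]
  · have hlt : (Tree.ofNat c.num.natAbs).num * (Tree.ofNat d.den).num <
        (Tree.ofNat d.num.natAbs).num * (Tree.ofNat c.den).num := by
      simp only [Tree.num_ofNat]
      zify
      rwa [abs_of_nonneg hcnonneg, abs_of_nonneg hdnonneg]
    exact (reaches_mulLt (by omega) (by omega) (by omega) (by omega) hM hlt p).bind fun q _ hq =>
      .of_holds ⟨hcden, hdden, Or.inr (Or.inl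
        ⟨by simp [Tree.ofRat, hcnonneg.not_gt, Tree.ofBool],
          by simp [Tree.ofRat, hdnonneg.not_gt, Tree.ofBool], hq⟩)⟩

end

/-! ### Completeness of derivations -/

/-- The image of a fact when its sides are mapped by `φ`. -/
def Fact.map {α β : Type*} (φ : α → β) : Fact α → Fact β
  | le t u => le (φ t) (φ u)
  | lt t u => lt (φ t) (φ u)
  | ne t u => ne (φ t) (φ u)

/-- The line of a derivation that states a fact about terms. -/
def Line.ofFact (f : Fact Term) : Line := fact (f.map Term.encode)

/-- The code of a substitution, restricted to a list of terms. -/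
def substCode (γ : ℕ → Term) (l : List Term) : Tree :=
  .ofList (l.map fun t => .cons t.encode (t.subst γ).encode)

/-- The line stating that a substitution sends one list of terms to another. -/
def Line.ofMatching (γ : ℕ → Term) (T l l' : List Term) : Line :=
  matching (substCode γ T) (.ofList (l.map Term.encode)) (.ofList (l'.map Term.encode))

theorem Fact.map_mem_asserts {α β : Type*} {φ : α → β} {f : Fact α} {op : CompOp} {l r : α}
    (h : f ∈ op.asserts l r) : f.map φ ∈ op.asserts (φ l) (φ r) := by
  cases op <;> simp only [CompOp.asserts, List.mem_cons, List.not_mem_nil, or_false] at h ⊢ <;>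
    rcases h with rfl | rfl <;> simp [map]

theorem Fact.map_mem_refutes {α β : Type*} {φ : α → β} {f : Fact α} {op : CompOp} {l r : α}
    (h : f ∈ op.refutes l r) : f.map φ ∈ op.refutes (φ l) (φ r) := by
  cases op <;> simp only [CompOp.refutes, List.mem_cons, List.not_mem_nil, or_false] at h ⊢ <;>
    rcases h with rfl | rfl <;> simp [map]

theorem OrderStep.map {α β : Type*} {φ : α → β} {F : Set (Fact α)} {G : Set (Fact β)} {f : Fact α}
    (h : OrderStep F f) (hFG : ∀ g ∈ F, g.map φ ∈ G) : OrderStep G (f.map φ) := by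
  cases f with
  | le t u =>
    rcases h with rfl | h | ⟨m, h, h'⟩
    · exact Or.inl rfl
    · exact Or.inr (Or.inl (hFG _ h))
    · exact Or.inr (Or.inr ⟨φ m, hFG _ h, hFG _ h'⟩)
  | lt t u =>
    rcases h with ⟨h, h'⟩ | ⟨m, h, h'⟩
    · exact Or.inl ⟨hFG _ h, hFG _ h'⟩
    · exact Or.inr ⟨φ m, hFG _ h, hFG _ h'⟩
  | ne t u => exact h

theorem Term.encode_injective : Function.Injective Term.encode := by
  rintro (x | c) (y | d) h
  · rw [Tree.ofNat_injective (Tree.cons.inj h).2]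
  · cases (Tree.cons.inj h).1
  · cases (Tree.cons.inj h).1
  · rw [← Tree.rat_ofRat c, (Tree.cons.inj h).2, Tree.rat_ofRat]

theorem cons_mem_substCode {γ : ℕ → Term} {l : List Term} {t : Term} (ht : t ∈ l) :
    .cons t.encode (t.subst γ).encode ∈ (substCode γ l).toList :=
  mem_toList_ofList_map.2 ⟨t, ht, rfl⟩

theorem isSubst_substCode (γ : ℕ → Term) (l : List Term) : IsSubst (substCode γ l) := by
  refine ⟨fun r hr r' hr' h => ?_, fun r hr h => ?_⟩
  · obtain ⟨t, -, rfl⟩ := mem_toList_ofList_map.1 hr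
    obtain ⟨t', -, rfl⟩ := mem_toList_ofList_map.1 hr'
    rw [Term.encode_injective h]
  · obtain ⟨x | c, -, rfl⟩ := mem_toList_ofList_map.1 hr
    · exact absurd rfl h
    · rfl

section Sizes

variable {Q : CQAC}

theorem length_flatMap_le_size_ofList {α β : Type*} {l : List α} {f : α → List β} {enc : α → Tree}
    (h : ∀ a ∈ l, (f a).length ≤ (enc a).size) :
    (l.flatMap f).length ≤ (Tree.ofList (l.map enc)).size := by
  induction l with
  | nil => simp
  | cons a l ih =>
    have ha := h a List.mem_cons_self
    have hl := ih fun b hb => h b (List.mem_cons_of_mem a hb)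
    simp only [List.flatMap_cons, List.length_append, List.map_cons, Tree.ofList, Tree.size]
    omega

theorem CQAC.size_encode_head_lt : (Tree.ofList (Q.head.map Term.encode)).size < Q.encode.size := by
  simp only [encode, Tree.size]
  omega

theorem CQAC.length_body_lt : Q.body.length < Q.encode.size := by
  have := Tree.length_le_size_ofList (Q.body.map Atom.encode)
  rw [List.length_map] at this
  simp only [encode, Tree.size]
  omega

theorem CQAC.size_encode_args_lt {a : Atom} (ha : a ∈ Q.body) :
    (Tree.ofList (a.args.map Term.encode)).size < Q.encode.size := by
  have := Tree.size_le_size_ofList (List.mem_map_of_mem (f := Atom.encode) ha)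
  simp only [encode, Atom.encode, Tree.size] at this ⊢
  omega

theorem CQAC.length_terms_le : Q.terms.length ≤ Q.encode.size := by
  have hhead := Tree.length_le_size_ofList (Q.head.map Term.encode)
  have hbody : (Q.body.flatMap Atom.args).length ≤ _ :=
    length_flatMap_le_size_ofList (enc := Atom.encode) fun a _ => by
      have := Tree.length_le_size_ofList (a.args.map Term.encode)
      rw [List.length_map] at this
      simp only [Atom.encode, Tree.size]
      omega
  have hcomps : (Q.comps.flatMap fun e => [Term.var e.lhs, e.rhs]).length ≤ _ :=
    length_flatMap_le_size_ofList (enc := Comparison.encode) fun e _ => by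
      have := e.op.encode.size_pos
      have := e.rhs.encode.size_pos
      simp only [Comparison.encode, Tree.size, List.length_cons, List.length_nil]
      omega
  rw [List.length_map] at hhead
  simp only [terms, encode, Tree.size, List.length_append]
  omega

theorem CQAC.size_encode_le_of_mem_terms {t : Term} (ht : t ∈ Q.terms) :
    t.encode.size ≤ Q.encode.size := by
  simp only [terms, List.mem_append, List.mem_flatMap] at ht
  rcases ht with (ht | ⟨a, ha, ht⟩) | ⟨e, he, ht⟩
  · exact (Tree.size_le_size_ofList (List.mem_map_of_mem ht)).trans size_encode_head_lt.le
  · exact (Tree.size_le_size_ofList (List.mem_map_of_mem ht)).trans (size_encode_args_lt ha).le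
  · have hsize := Tree.size_le_size_ofList (List.mem_map_of_mem (f := Comparison.encode) he)
    have hop := e.op.encode.size_pos
    simp only [Comparison.encode, Tree.size] at hsize
    simp only [encode, Tree.size]
    rcases List.mem_pair.1 ht with rfl | rfl
    · simp only [Term.encode, Tree.ofBool, Tree.size]
      omega
    · omega

variable {Q₂ Q₁ : CQAC}

theorem card_pairTerms_le : (pairTerms Q₂ Q₁).card ≤ (Tree.cons Q₂.encode Q₁.encode).size := by
  classical
  have h₂ := Q₂.length_terms_le
  have h₁ := Q₁.length_terms_le
  refine (List.toFinset_card_le _).trans ?_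
  rw [List.length_append, Tree.size]
  omega

theorem size_encode_le_of_mem_pairTerms {t : Term} (ht : t ∈ pairTerms Q₂ Q₁) :
    t.encode.size ≤ (Tree.cons Q₂.encode Q₁.encode).size := by
  classical
  rw [Tree.size]
  rcases List.mem_append.1 (List.mem_toFinset.1 ht) with ht | ht
  · linarith [CQAC.size_encode_le_of_mem_terms ht]
  · linarith [CQAC.size_encode_le_of_mem_terms ht]

theorem size_substCode_le {γ : ℕ → Term} (hγ : ∀ t ∈ Q₁.terms, t.subst γ ∈ pairTerms Q₂ Q₁) {s : ℕ}
    (hs : (Tree.cons Q₂.encode Q₁.encode).size = s) :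
    (substCode γ Q₁.terms).size ≤ s * (2 * s + 2) + 1 := by
  have hpair : ∀ r ∈ Q₁.terms.map fun t => Tree.cons t.encode (t.subst γ).encode,
      r.size ≤ 2 * s + 1 := by
    intro r hr
    obtain ⟨t, ht, rfl⟩ := List.mem_map.1 hr
    have := size_encode_le_of_mem_pairTerms (mem_pairTerms_right (Q₂ := Q₂) ht)
    have := size_encode_le_of_mem_pairTerms (hγ t ht)
    rw [Tree.size]
    omega
  refine (Tree.size_ofList_le hpair).trans ?_
  have : Q₁.terms.length ≤ s := by
    have := Q₁.length_terms_le
    rw [Tree.size] at hs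
    omega
  rw [List.length_map]
  gcongr

theorem size_encode_ofFact_le {f : Fact Term} (hf : f.Over (pairTerms Q₂ Q₁ : Set Term)) :
    (Line.ofFact f).encode.size ≤ 2 * (Tree.cons Q₂.encode Q₁.encode).size + 15 :=
  Line.size_encode_fact_le <| by
    cases f <;> exact hf.imp size_encode_le_of_mem_pairTerms size_encode_le_of_mem_pairTerms

end Sizes

section

variable {q₂ q₁ : Tree} {M : ℕ} {p : Set Line} {F : Set (Fact Term)}

theorem reaches_lt_const {c d : ℚ} {s : ℕ} (hc : (Term.const c).encode.size ≤ s)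
    (hd : (Term.const d).encode.size ≤ s) (hM : 24 * s + 24 ≤ M) (h : c < d) (p : Set Line) :
    Reaches q₂ q₁ M p ((2 * s + 1) * M + 1) (Line.ofFact (.lt (.const c) (.const d)) ∈ ·) := by
  have hsize : (Line.ofFact (.lt (.const c) (.const d))).encode.size ≤ 2 * s + 15 :=
    Line.size_encode_fact_le ⟨hc, hd⟩
  simp only [Term.encode, Tree.size] at hc hd
  refine (reaches_ratLt (by omega) (by omega) hM h p).bind fun q _ hq => ?_
  have hstep : Justified q₂ q₁ q (.ofFact (.lt (.const c) (.const d))) := Or.inr (Or.inr (Or.inl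
    ⟨by simp [Term.encode, Tree.ofBool], by simp [Term.encode, Tree.ofBool], hq⟩))
  exact .of_justified hstep (by omega)

theorem ProvEq.encode {t u : Term} (h : ProvEq F t u) (hF : ∀ f ∈ F, .ofFact f ∈ p) :
    ProvEq (Line.fact ⁻¹' p) t.encode u.encode :=
  ⟨hF _ h.1, hF _ h.2⟩

theorem reaches_matching {γ : ℕ → Term} {T l l' : List Term}
    (h : List.Forall₂ (fun t u => ProvEq F (t.subst γ) u) l l') (hl : ∀ t ∈ l, t ∈ T)
    (hF : ∀ f ∈ F, .ofFact f ∈ p)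
    (hM : (substCode γ T).size + (Tree.ofList (l.map Term.encode)).size +
      (Tree.ofList (l'.map Term.encode)).size + 16 ≤ M) :
    Reaches q₂ q₁ M p (l.length + 1) (.ofMatching γ T l l' ∈ ·) := by
  have hsize := (Line.size_encode_matching_le _ _ _).trans hM
  induction h with
  | nil =>
    have hstep : Justified q₂ q₁ p (.ofMatching γ T [] []) := Or.inl ⟨rfl, rfl⟩
    exact (Reaches.of_justified hstep hsize).mono (by simp)
  | @cons t u l l' htu _ ih =>
    have hM' : (substCode γ T).size + (Tree.ofList (l.map Term.encode)).size +
        (Tree.ofList (l'.map Term.encode)).size + 16 ≤ M := by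
      simp only [List.map_cons, Tree.ofList, Tree.size] at hM
      omega
    refine (ih (fun v hv => hl v (List.mem_cons_of_mem t hv)) hM'
      ((Line.size_encode_matching_le _ _ _).trans hM')).bind fun q hpq hq => ?_
    have hstep : Justified q₂ q₁ q (.ofMatching γ T (t :: l) (u :: l')) :=
      Or.inr ⟨by simp [Tree.ofList], by simp [Tree.ofList], hq, _,
        cons_mem_substCode (hl t List.mem_cons_self), rfl, htu.encode fun f hf => hpq (hF f hf)⟩
    exact .of_justified hstep hsize

end

section

variable {Q₂ Q₁ : CQAC} {M s : ℕ} {p : Set Line} {F : Set (Fact Term)}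
  {μ : ContainmentMapping Q₁ Q₂} {γ : ℕ → Term} {f : Fact Term}

theorem reaches_comparison {q₁ : Tree} {e : Comparison} (he : e ∈ Q₂.comps)
    (hf : f ∈ e.op.asserts (.var e.lhs) e.rhs) (hM : (Line.ofFact f).encode.size ≤ M) :
    Reaches Q₂.encode q₁ M p 1 (Line.ofFact f ∈ ·) := by
  have hstep : Justified Q₂.encode q₁ p (.ofFact f) := Or.inr (Or.inl
    ⟨e.encode, mem_toList_ofList_map.2 ⟨e, he, rfl⟩, e.op, rfl, Fact.map_mem_asserts hf⟩)
  exact .of_justified hstep hM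

theorem Applicable.equationOrRefuted (H : Applicable F μ γ f) (hF : ∀ f ∈ F, .ofFact f ∈ p)
    {e : Comparison} (he : e ∈ Q₁.comps) :
    EquationOrRefuted (Line.fact ⁻¹' p) (substCode γ Q₁.terms) e.encode (f.map Term.encode) := by
  obtain ⟨hl, hr⟩ := CQAC.mem_terms_of_comps he
  refine ⟨_, cons_mem_substCode hl, _, cons_mem_substCode hr, rfl, rfl, e.op, rfl, ?_⟩
  exact (H.comps e he).imp (fun h => ⟨h.1, h.2.encode hF⟩) Fact.map_mem_refutes

theorem Applicable.mappingStep (H : Applicable F μ γ f) (hF : ∀ f ∈ F, .ofFact f ∈ p)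
    (hhead : .ofMatching γ Q₁.terms Q₁.head Q₂.head ∈ p)
    (hbody : ∀ i,
      .ofMatching γ Q₁.terms (Q₁.body.get i).args (Q₂.body.get (μ.toFun i)).args ∈ p) :
    MappingStep Q₂.encode Q₁.encode p (f.map Term.encode) := by
  refine ⟨_, hhead, isSubst_substCode γ _, fun a ha => ?_, fun e he => ?_⟩
  · obtain ⟨a, ha', rfl⟩ := mem_toList_ofList_map.1 ha
    obtain ⟨i, rfl⟩ := List.get_of_mem ha'
    exact ⟨_, mem_toList_ofList_map.2 ⟨_, List.get_mem _ (μ.toFun i), rfl⟩,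
      congrArg Tree.ofNat (μ.rel_eq i), hbody i⟩
  · obtain ⟨e, he', rfl⟩ := mem_toList_ofList_map.1 he
    exact H.equationOrRefuted hF he'

theorem Applicable.reaches (H : Applicable F μ γ f) (hF : ∀ f ∈ F, .ofFact f ∈ p)
    (hs : (Tree.cons Q₂.encode Q₁.encode).size = s)
    (hM : (substCode γ Q₁.terms).size + s + 16 ≤ M) (hf : (Line.ofFact f).encode.size ≤ M) :
    Reaches Q₂.encode Q₁.encode M p (s + s * s + 1) (Line.ofFact f ∈ ·) := by
  rw [Tree.size] at hs
  have hhead : Reaches Q₂.encode Q₁.encode M p s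
      (.ofMatching γ Q₁.terms Q₁.head Q₂.head ∈ ·) := by
    have h₁ := Q₁.size_encode_head_lt
    have h₂ := Q₂.size_encode_head_lt
    have hlen := Tree.length_le_size_ofList (Q₁.head.map Term.encode)
    rw [List.length_map] at hlen
    exact (reaches_matching H.head (fun t => CQAC.mem_terms_of_head) hF (by omega)).mono (by omega)
  have hbody : ∀ i ∈ List.finRange Q₁.body.length, ∀ q, p ⊆ q →
      Reaches Q₂.encode Q₁.encode M q s
        (.ofMatching γ Q₁.terms (Q₁.body.get i).args (Q₂.body.get (μ.toFun i)).args ∈ ·) := by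
    intro i _ q hpq
    have h₁ := CQAC.size_encode_args_lt (Q₁.body.get_mem i)
    have h₂ := CQAC.size_encode_args_lt (Q₂.body.get_mem (μ.toFun i))
    have hlen := Tree.length_le_size_ofList ((Q₁.body.get i).args.map Term.encode)
    rw [List.length_map] at hlen
    exact (reaches_matching (H.body i) (fun t => CQAC.mem_terms_of_body (List.get_mem _ i))
      (fun f hf => hpq (hF f hf)) (by omega)).mono (by omega)
  have hlast : ∀ q, p ⊆ q → .ofMatching γ Q₁.terms Q₁.head Q₂.head ∈ q → ∀ r, q ⊆ r →
      (∀ i ∈ List.finRange Q₁.body.length,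
        .ofMatching γ Q₁.terms (Q₁.body.get i).args (Q₂.body.get (μ.toFun i)).args ∈ r) →
      Reaches Q₂.encode Q₁.encode M r 1 (Line.ofFact f ∈ ·) := by
    intro q hpq hq r hqr hr
    have hstep : Justified Q₂.encode Q₁.encode r (.ofFact f) :=
      Or.inr (Or.inr (Or.inr (H.mappingStep (fun f hf => hqr (hpq (hF f hf))) (hqr hq)
        fun i => hr i (List.mem_finRange i))))
    exact .of_justified hstep hf
  refine (hhead.bind fun q hpq hq => (Reaches.forall_mem fun i hi r hr =>
    hbody i hi r (hpq.trans hr)).bind fun r hqr hr => hlast q hpq hq r hqr hr.2).mono ?_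
  have hlength := Q₁.length_body_lt
  rw [List.length_finRange, ← add_assoc]
  gcongr
  omega

theorem exists_reaches_saturated (q₂ q₁ : Tree) (M N : ℕ) (T : Finset Term) :
    ∃ A : Set (Fact Term), (∀ f ∈ A, f.Over T) ∧
      Reaches q₂ q₁ M ∅ (3 * T.card ^ 2 * N) (fun q => ∀ f ∈ A, .ofFact f ∈ q) ∧
      ∀ f : Fact Term, f.Over T →
        (∀ q : Set Line, (∀ g ∈ A, .ofFact g ∈ q) → Reaches q₂ q₁ M q N (Line.ofFact f ∈ ·)) →
          f ∈ A := by
  classical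
  obtain ⟨A, hAT, hA, hsat⟩ := exists_saturated (factsOver T)
    (P := fun A => Reaches q₂ q₁ M ∅ (A.card * N) fun q => ∀ f ∈ A, .ofFact f ∈ q)
    ((Reaches.of_holds (by simp)).mono (Nat.zero_le _))
  have hcard := (Finset.card_le_card hAT).trans (card_factsOver_le T)
  refine ⟨A, fun f hf => mem_factsOver.1 (hAT hf), hA.mono (by gcongr), fun f hf hstep => ?_⟩
  by_contra hmem
  refine hmem (hsat f (mem_factsOver.2 hf) ?_)
  rw [Finset.card_insert_of_notMem hmem, Nat.succ_mul]
  refine hA.bind fun q _ hq => ?_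
  obtain ⟨k, hk, r, hr, hfr⟩ := hstep q hq
  exact ⟨k, hk, r, hr, Finset.forall_mem_insert _ _ _ |>.2 ⟨hfr, fun g hg => hr.subset (hq g hg)⟩⟩

/-- A bound for the codes of the lines that occur in short derivations. -/
def lineBound (s : ℕ) : ℕ := 2 * s ^ 2 + 26 * s + 24

/-- A bound for the number of derivation steps that produce the next fact. -/
def stepBound (s : ℕ) : ℕ := (2 * s + 1) * lineBound s + (s + s * s + 1)

theorem closed_of_reaches {q₁ : Tree} {A : Set (Fact Term)} {T : Finset Term}
    (hT₂ : ∀ t ∈ Q₂.terms, t ∈ T) (hT : ∀ t ∈ T, t.encode.size ≤ s)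
    (hover : ∀ f ∈ A, f.Over T)
    (hsat : ∀ f : Fact Term, f.Over T → (∀ p : Set Line, (∀ g ∈ A, .ofFact g ∈ p) →
      Reaches Q₂.encode q₁ (lineBound s) p (stepBound s) (Line.ofFact f ∈ ·)) → f ∈ A) :
    Closed Q₂ T A := by
  have hsize : ∀ f : Fact Term, f.Over T → (Line.ofFact f).encode.size ≤ lineBound s := by
    intro f hf
    refine (Line.size_encode_fact_le (s := s) ?_).trans (by unfold lineBound; nlinarith)
    cases f <;> exact hf.imp (hT _) (hT _)
  have hone : 1 ≤ stepBound s := by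
    unfold stepBound
    omega
  refine ⟨hover, fun f hf h => hsat f hf fun p hp => ?_, fun c d hc hd h =>
    hsat _ ⟨hc, hd⟩ fun p _ => ?_, fun e he f hf => ?_⟩
  · have hstep : Justified Q₂.encode q₁ p (.ofFact f) := Or.inl (h.map hp)
    exact (Reaches.of_justified hstep (hsize f hf)).mono hone
  · refine (reaches_lt_const (hT _ hc) (hT _ hd) ?_ h p).mono ?_
    · unfold lineBound
      nlinarith
    · unfold stepBound
      omega
  · obtain ⟨hl, hr⟩ := CQAC.mem_terms_of_comps he
    have hfT := CompOp.over_asserts (T := (T : Set Term)) (hT₂ _ hl) (hT₂ _ hr) f hf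
    exact hsat f hfT fun p _ => (reaches_comparison he hf (hsize f hfT)).mono hone

theorem exists_isRefutation {D : Type*} [LinearOrder D] {ι : ℚ ↪o D} (hc : Contained ι Q₂ Q₁)
    (hQ₁ : Q₁.HasOneAC) (hs : (Tree.cons Q₂.encode Q₁.encode).size = s) :
    ∃ y : Tree, y.size ≤ 3 * s ^ 2 * stepBound s * (lineBound s + 1) + 1 ∧
      IsRefutation Q₂.encode Q₁.encode y := by
  obtain ⟨A, hover, hA, hsat⟩ := exists_reaches_saturated Q₂.encode Q₁.encode (lineBound s)
    (stepBound s) (pairTerms Q₂ Q₁)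
  have hclosed : Closed Q₂ (pairTerms Q₂ Q₁) A := closed_of_reaches (fun t => mem_pairTerms_left)
    (fun t ht => hs ▸ size_encode_le_of_mem_pairTerms ht) hover hsat
  obtain ⟨t, ht⟩ := hclosed.exists_lt_self_mem hc hQ₁ fun μ γ f happ hγ hf => by
    refine hsat f hf fun p hp => (happ.reaches hp hs ?_ ?_).mono (Nat.le_add_left _ _)
    · have := size_substCode_le hγ hs
      unfold lineBound
      nlinarith
    · have := size_encode_ofFact_le hf
      unfold lineBound
      nlinarith
  have hrefuted : Reaches Q₂.encode Q₁.encode (lineBound s) ∅ (3 * s ^ 2 * stepBound s)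
      fun q => ∃ t, .fact (.lt t t) ∈ q := by
    obtain ⟨k, hk, q, hq, hAq⟩ := hA
    have hcard := hs ▸ card_pairTerms_le (Q₂ := Q₂) (Q₁ := Q₁)
    exact ⟨k, hk.trans (by gcongr), q, hq, _, hAq _ ht⟩
  exact hrefuted.exists_isRefutation

end

open Polynomial in
theorem inNP_contained {D : Type*} [LinearOrder D] (ι : ℚ ↪o D) :
    InNP Instance.encode fun a => Contained ι a.Q₂ a.Q₁ := by
  have hcheck : Checkable fun v => IsRefutation v.hd.hd v.hd.tl v.tl :=
    checkable_isRefutation Elementary.id.hd.hd Elementary.id.hd.tl Elementary.id.tl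
  let line : ℕ[X] := 2 * X ^ 2 + 26 * X + 24
  let step : ℕ[X] := (2 * X + 1) * line + (X + X * X + 1)
  refine inNP_of_checkable hcheck (3 * X ^ 2 * step * (line + 1) + 1)
    (fun a y (hy : IsRefutation a.Q₂.encode a.Q₁.encode y) => hy.contained) fun a ha => ?_
  obtain ⟨y, hsize, hy⟩ := exists_isRefutation ha a.oneAC rfl
  exact ⟨y, hsize.trans_eq (by simp [line, step, lineBound, stepBound, Instance.encode]), hy⟩

open Polynomial in
theorem exists_polynomial_contained_iff {D : Type*} [LinearOrder D] (ι : ℚ ↪o D) :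
    ∃ p : ℕ[X], ∀ a : Instance, Contained ι a.Q₂ a.Q₁ ↔
      ∃ L : List (ContainmentMapping a.Q₁ a.Q₂),
        L.length ≤ p.eval a.encode.size ∧ Certifies ι L := by
  refine ⟨3 * X ^ 2, fun a => ⟨fun ha => ?_, fun ⟨L, _, hL⟩ => hL.contained⟩⟩
  obtain ⟨L, hlen, hL⟩ := exists_certifies ha a.oneAC
  have hcard : (pairTerms a.Q₂ a.Q₁).card ≤ a.encode.size := card_pairTerms_le
  refine ⟨L, hlen.trans ?_, hL⟩
  simp only [eval_mul, eval_pow, eval_X, eval_ofNat]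
  gcongr

end CQ

theorem mainTheorem8_general {D : Type*} [LinearOrder D] (ι : ℚ ↪o D) :
    CompModel.InNP CQ.Instance.encode (fun a => CQ.Contained ι a.Q₂ a.Q₁) ∧
    ∃ p : Polynomial ℕ, ∀ a : CQ.Instance,
      CQ.Contained ι a.Q₂ a.Q₁ ↔
        ∃ L : List (CQ.ContainmentMapping a.Q₁ a.Q₂),
          L.length ≤ p.eval a.encode.size ∧ CQ.Certifies ι L :=
  ⟨CQ.inNP_contained ι, CQ.exists_polynomial_contained_iff ι⟩

theorem mainTheorem8 {D : Type*} [LinearOrder D] [DenselyOrdered D] (ι : ℚ ↪o D) :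
    CompModel.InNP CQ.Instance.encode (fun a => CQ.Contained ι a.Q₂ a.Q₁) ∧
    ∃ p : Polynomial ℕ, ∀ a : CQ.Instance,
      CQ.Contained ι a.Q₂ a.Q₁ ↔
        ∃ L : List (CQ.ContainmentMapping a.Q₁ a.Q₂),
          L.length ≤ p.eval a.encode.size ∧ CQ.Certifies ι L :=
  mainTheorem8_general ι
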